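/- Let $\mathbb{T}$ be the unit circle with normalized Lebesgue measure, let $H^2\subset L^2=L^2(\mathbb{T})$ be the Hardy space (the functions in $L^2$ whose Fourier coefficients of negative index all vanish), let $H^\infty=L^\infty\cap H^2$, and let $\mathcal{R}$ be the set of (restrictions to $\mathbb{T}$ of) rational functions $p/q$ such that all zeros of $q$ lie in the open unit disk. Let $\theta$ be an inner function, i.e. $\theta\in H^\infty$ with $|\theta|=1$ a.e. on $\mathbb{T}$, put $\breve\theta(\xi)=\theta(\bar\xi)$, let $K_\theta=H^2\cap(\theta H^2)^\perp$ be the model space and let $P_\theta:L^2\to K_\theta$ be the orthogonal projection. Let $(\mathcal{J}f)(\xi)=\bar\xi f(\bar\xi)$ be the flip operator on $L^2$. For $\phi\in L^\infty$ let $T_\phi^\theta:K_\theta\to K_\theta^\perp$, $T_\phi^\theta f=(I-P_\theta)\mathcal{J}(\phi f)$, be the big truncated Toeplitz operator. Then: (i) if $\theta$ is non-constant, $T_\phi^\theta=0$ if and only if $\phi\in\overline{\theta H^\infty}\cap\breve\theta H^\infty$; (ii) $T_\phi^\theta$ has finite rank if and only if $\theta$ is a finite Blaschke product (unimodular constants included)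 or $\phi\in\overline{\theta(H^\infty+\mathcal{R})}\cap\breve\theta(H^\infty+\mathcal{R})$. -/

import Mathlib

open MeasureTheory AddCircle
open scoped ENNReal ComplexConjugate Pointwise

noncomputable section

namespace BTTO

/-!
The unit circle is modelled by `UnitAddCircle = ℝ / ℤ` through `t ↦ ξ = exp (2 π i t)`, with its
normalized Haar measure. In this model `fourier n t = ξ ^ n`, and `-t` corresponds to the complex
conjugate of `ξ`.
-/

/-- Normalized Lebesgue measure on the circle. -/
abbrev circleMeasure : Measure UnitAddCircle := haarAddCircle

/-- `L²` of the circle. -/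
abbrev L2 : Type := Lp ℂ 2 circleMeasure

/-- `L^∞` of the circle. -/
abbrev LInf : Type := Lp ℂ ∞ circleMeasure

/-- Complex conjugation of the circle, `t ↦ -t`, preserves the measure. -/
theorem measurePreserving_neg :
    MeasurePreserving (fun t : UnitAddCircle => -t) circleMeasure circleMeasure :=
  Measure.measurePreserving_neg circleMeasure

/-- The reflection `f˘ (ξ) = f (conj ξ)` of an essentially bounded function. -/
def breve (f : LInf) : LInf :=
  Lp.compMeasurePreserving (fun t : UnitAddCircle => -t) measurePreserving_neg f

theorem coeFn_breve (f : LInf) : breve f =ᵐ[circleMeasure] fun t => f (-t) :=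
  Lp.coeFn_compMeasurePreserving f measurePreserving_neg

/-- The multiplication operator `M_φ : L² → L²`, `f ↦ φ f`, for `φ ∈ L^∞`. -/
def mulOp (φ : LInf) : L2 →L[ℂ] L2 :=
  (ContinuousLinearMap.mul ℂ ℂ).holderL circleMeasure ∞ 2 2 φ

theorem coeFn_mulOp (φ : LInf) (f : L2) :
    mulOp φ f =ᵐ[circleMeasure] fun t => φ t * f t :=
  (ContinuousLinearMap.mul ℂ ℂ).coeFn_holder φ f

/-- The product of two essentially bounded functions. -/
def mulInf (φ ψ : LInf) : LInf :=
  (ContinuousLinearMap.mul ℂ ℂ).holder ∞ φ ψ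

theorem coeFn_mulInf (φ ψ : LInf) :
    mulInf φ ψ =ᵐ[circleMeasure] fun t => φ t * ψ t :=
  (ContinuousLinearMap.mul ℂ ℂ).coeFn_holder φ ψ

/-- The flip operator on `L²`, `(J f) (ξ) = conj ξ * f (conj ξ)`. -/
def flip : L2 →L[ℂ] L2 :=
  mulOp (fourierLp ∞ (-1)) ∘L
    (Lp.compMeasurePreservingₗᵢ ℂ (fun t : UnitAddCircle => -t)
      measurePreserving_neg).toContinuousLinearMap

theorem coeFn_flip (f : L2) :
    flip f =ᵐ[circleMeasure] fun t => conj (toCircle t : ℂ) * f (-t) := by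
  have h1 := coeFn_mulOp (fourierLp ∞ (-1))
    (Lp.compMeasurePreserving (fun t : UnitAddCircle => -t) measurePreserving_neg f)
  have h2 := coeFn_fourierLp (T := 1) ∞ (-1)
  have h3 := Lp.coeFn_compMeasurePreserving f measurePreserving_neg
  refine Filter.EventuallyEq.trans h1 ?_
  filter_upwards [h2, h3] with t ht2 ht3
  rw [ht2, ht3, fourier_neg, fourier_one]
  rfl

/-- The Hardy space `H²`: the functions in `L²` whose Fourier coefficients of negative index
vanish. -/
def H2 : Submodule ℂ L2 where
  carrier := {f | ∀ n : ℤ, n < 0 → fourierCoeff f n = 0}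
  add_mem' {f g} hf hg n hn := by
    rw [← fourierBasis_repr, map_add, lp.coeFn_add, Pi.add_apply, fourierBasis_repr,
      fourierBasis_repr, hf n hn, hg n hn, add_zero]
  zero_mem' n _ := by
    rw [← fourierBasis_repr, map_zero]; rfl
  smul_mem' c f hf n hn := by
    rw [← fourierBasis_repr, map_smul, lp.coeFn_smul, Pi.smul_apply, fourierBasis_repr,
      hf n hn, smul_zero]

theorem isClosed_H2 : IsClosed (H2 : Set L2) := by
  have h : (H2 : Set L2) =
      ⋂ n : ℤ, ⋂ _ : n < 0, {f : L2 | inner ℂ (fourierBasis (T := 1) n) f = 0} := by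
    ext f
    simp only [Set.mem_iInter, Set.mem_ofPred_eq]
    refine forall_congr' fun n => forall_congr' fun _ => ?_
    rw [← HilbertBasis.repr_apply_apply, fourierBasis_repr]
  rw [h]
  exact isClosed_iInter fun n => isClosed_iInter fun _ =>
    isClosed_eq (continuous_const.inner continuous_id) continuous_const

/-- `H^∞ = L^∞ ∩ H²`. -/
def HInf : Set LInf := {φ | ∀ n : ℤ, n < 0 → fourierCoeff φ n = 0}

/-- Inner functions: elements of `H^∞` that are unimodular almost everywhere on the circle. -/
def IsInner (θ : LInf) : Prop := θ ∈ HInf ∧ ∀ᵐ t ∂circleMeasure, ‖θ t‖ = 1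

/-- The function is (almost everywhere) equal to a constant. -/
def IsConstant (θ : LInf) : Prop := ∃ c : ℂ, θ =ᵐ[circleMeasure] fun _ => c

/-- Finite Blaschke products `c ∏ (ξ - aᵢ) / (1 - conj aᵢ ξ)` with `|c| = 1` and all `aᵢ` in the
open unit disk; the empty product (a unimodular constant) is allowed. -/
def IsFiniteBlaschke (θ : LInf) : Prop :=
  ∃ (n : ℕ) (a : Fin n → ℂ) (c : ℂ), (∀ i, ‖a i‖ < 1) ∧ ‖c‖ = 1 ∧
    θ =ᵐ[circleMeasure] fun t =>
      c * ∏ i, ((toCircle t : ℂ) - a i) / (1 - conj (a i) * (toCircle t : ℂ))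

/-- `ℛ`: (boundary values of) the rational functions `p / q` such that all zeros of `q` lie in the
open unit disk. The condition on `q` forces `q ≠ 0`. -/
def RatFun : Set LInf :=
  {r | ∃ p q : Polynomial ℂ, (∀ z : ℂ, q.eval z = 0 → ‖z‖ < 1) ∧
    r =ᵐ[circleMeasure] fun t => p.eval (toCircle t : ℂ) / q.eval (toCircle t : ℂ)}

/-- The model space `K_θ`, the orthogonal complement of `θ H²` in `H²`. -/
def modelSpace (θ : LInf) : Submodule ℂ L2 :=
  H2 ⊓ (H2.map (mulOp θ).toLinearMap)ᗮ

instance completeSpace_modelSpace (θ : LInf) : CompleteSpace (modelSpace θ) := by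
  have h : IsClosed (modelSpace θ : Set L2) :=
    isClosed_H2.inter (Submodule.isClosed_orthogonal _)
  exact h.completeSpace_coe

/-- The big truncated Toeplitz operator `T_φ^θ : K_θ → (K_θ)ᗮ`,
`T_φ^θ f = (I - P_θ) J (φ f)`, with `P_θ : L² → K_θ` the orthogonal projection. -/
def bigTTO (θ φ : LInf) : modelSpace θ →L[ℂ] (modelSpace θ)ᗮ :=
  ((ContinuousLinearMap.id ℂ L2 - (modelSpace θ).starProjection) ∘L flip ∘L mulOp φ ∘L
    (modelSpace θ).subtypeL).codRestrict (modelSpace θ)ᗮ fun f =>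
      Submodule.sub_starProjection_mem_orthogonal (K := modelSpace θ) (flip (mulOp φ f))

/-- A bounded operator has finite rank if its range is finite-dimensional. -/
def IsFiniteRank {E F : Type*} [NormedAddCommGroup E] [NormedSpace ℂ E]
    [NormedAddCommGroup F] [NormedSpace ℂ F] (A : E →L[ℂ] F) : Prop :=
  FiniteDimensional ℂ A.toLinearMap.range

end BTTO

end

/-! The operator kills f exactly when J(φf) lies in the model space, that is, when φf is
antianalytic and conj(θ˘)φf is analytic. With the symbols ψ₁ = conj(θφ) and ψ₂ = conj(θ˘)φ, and the
conjugation Cf = θ·conj(zf) of the model space, antianalyticity of φ·Cf says that ψ₁f is analytic,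
and antianalyticity of φf says that ψ₁·Cf is. So if f and Cf both lie in the kernel, then ψf and
ψ·Cf are analytic for both symbols ψ.

Apply this to g = P_θ a for a polynomial a of degree n. Here g = a − bθ with b a polynomial of
degree at most n, and Cg = conj z·(conj(a)θ − conj b). Eliminating θ between g and Cg leaves P =
zⁿ(|a|² − |b|²), a polynomial of degree at most 2n, with Pψ analytic; it is nonzero unless g = 0
(`exists_circ_mul_hardy`). If the operator is zero, a = 1 makes P a constant, so both symbols lie in
H^∞. If it has finite rank, a dimension count over ℝ gives a ≠ 0 with g and Cg in the kernel. Then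
either g = 0, so that θ is a quotient of polynomials and hence a finite Blaschke product
(`isFiniteBlaschke_of_circ_mul`), or Pψ is analytic and dividing by P puts ψ in H^∞ + ℛ
(`exists_rational_of_circ_mul`).

Conversely, multiplication by a rational function of denominator Q preserves analyticity up to deg Q
linear conditions, so the kernel has finite codimension; for a finite Blaschke product the model
space itself has finite dimension. -/

namespace BTTO

open Filter Topology Polynomial

/-! ### Fourier coefficients of analytic and antianalytic functions -/

/-- All Fourier coefficients of negative index vanish. -/
def Hardy (f : UnitAddCircle → ℂ) : Prop := ∀ n : ℤ, n < 0 → fourierCoeff f n = 0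

/-- All Fourier coefficients of nonnegative index vanish. -/
def Anti (f : UnitAddCircle → ℂ) : Prop := ∀ n : ℤ, 0 ≤ n → fourierCoeff f n = 0

/-- The restriction of a polynomial to the circle. -/
noncomputable def circ (p : ℂ[X]) : UnitAddCircle → ℂ := fun t => p.eval (toCircle t : ℂ)

theorem Hardy.congr {f g : UnitAddCircle → ℂ} (hf : Hardy f) (h : f =ᵐ[circleMeasure] g) :
    Hardy g := fun n hn => by rw [← fourierCoeff_congr_ae h]; exact hf n hn

theorem Anti.congr {f g : UnitAddCircle → ℂ} (hf : Anti f) (h : f =ᵐ[circleMeasure] g) :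
    Anti g := fun n hn => by rw [← fourierCoeff_congr_ae h]; exact hf n hn

theorem fourierCoeff_toLp_two {f : UnitAddCircle → ℂ} (hf : MemLp f 2 circleMeasure) (n : ℤ) :
    fourierCoeff (hf.toLp f) n = fourierCoeff f n :=
  congrFun (fourierCoeff_congr_ae hf.coeFn_toLp) n

theorem inner_fourierBasis (n : ℤ) (g : L2) :
    inner ℂ (fourierBasis (T := 1) n) g = fourierCoeff g n := by
  rw [← HilbertBasis.repr_apply_apply, fourierBasis_repr]

theorem fourierCoeff_conj (f : UnitAddCircle → ℂ) (n : ℤ) :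
    fourierCoeff (fun t => conj (f t)) n = conj (fourierCoeff f (-n)) := by
  simp only [fourierCoeff, smul_eq_mul]
  rw [← integral_conj]
  congr 1; ext t
  rw [map_mul, ← fourier_neg, neg_neg]

theorem fourierCoeff_comp_neg (f : UnitAddCircle → ℂ) (n : ℤ) :
    fourierCoeff (fun t => f (-t)) n = fourierCoeff f (-n) := by
  simp only [fourierCoeff, smul_eq_mul]
  rw [← integral_neg_eq_self (fun t => (fourier (-(-n)) t : ℂ) * f t) haarAddCircle]
  congr 1; ext t
  congr 1
  rw [fourier_apply, fourier_apply]; congr 2; simp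

theorem fourierCoeff_fourier_mul (f : UnitAddCircle → ℂ) (k n : ℤ) :
    fourierCoeff (fun t => fourier k t * f t) n = fourierCoeff f (n - k) := by
  simp only [fourierCoeff, smul_eq_mul]
  congr 1; ext t
  rw [← mul_assoc, ← fourier_add]; congr 3; ring_nf

/-- The coefficient is the inner product of zⁿ·conj f with g. Parseval expands it into the terms
f̂(n − k)ĝ(k), each of which vanishes. -/
theorem fourierCoeff_mul_eq_zero {f g : UnitAddCircle → ℂ} (hf : MemLp f 2 circleMeasure)
    (hg : MemLp g 2 circleMeasure) {n : ℤ}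
    (h : ∀ k, fourierCoeff f (n - k) = 0 ∨ fourierCoeff g k = 0) :
    fourierCoeff (fun t => f t * g t) n = 0 := by
  have hu : MemLp (fun t => conj (f t)) 2 circleMeasure := hf.star
  have hu' : MemLp (fun t => (fourier n t : ℂ) * conj (f t)) 2 circleMeasure := by
    have h0 : MemLp (fun t : UnitAddCircle => (fourier n t : ℂ)) ∞ circleMeasure :=
      (map_continuous _).memLp_top_of_hasCompactSupport (HasCompactSupport.of_compactSpace _) _
    exact hu.mul h0
  have key := (fourierBasis (T := 1)).hasSum_inner_mul_inner (hu'.toLp _) (hg.toLp _)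
  have hz : ∀ k : ℤ, inner ℂ (hu'.toLp _) (fourierBasis (T := 1) k) *
      inner ℂ (fourierBasis (T := 1) k) (hg.toLp _) = 0 := by
    intro k
    rw [← inner_conj_symm, inner_fourierBasis, inner_fourierBasis, fourierCoeff_toLp_two,
      fourierCoeff_toLp_two, fourierCoeff_fourier_mul, fourierCoeff_conj, RCLike.conj_conj, neg_sub]
    rcases h k with h | h <;> simp [h]
  simp only [hz] at key
  have h1 := key.unique hasSum_zero
  rw [L2.inner_def] at h1
  rw [← h1]
  simp only [fourierCoeff]
  refine integral_congr_ae ?_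
  filter_upwards [hu'.coeFn_toLp, hg.coeFn_toLp] with t h2 h3
  rw [h2, h3, RCLike.inner_apply, map_mul, RCLike.conj_conj, fourier_neg, smul_eq_mul]
  ring

theorem ae_eq_zero_of_fourierCoeff {f : UnitAddCircle → ℂ} (hf : MemLp f 2 circleMeasure)
    (h : ∀ n, fourierCoeff f n = 0) : f =ᵐ[circleMeasure] 0 := by
  have : hf.toLp f = 0 := by
    apply (fourierBasis (T := 1)).repr.injective
    ext n
    rw [fourierBasis_repr, fourierCoeff_toLp_two, h, map_zero]; rfl
  have h1 := hf.coeFn_toLp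
  rw [this] at h1
  exact h1.symm.trans (Lp.coeFn_zero _ _ _)

theorem tendsto_fourierCoeff {f : UnitAddCircle → ℂ} (hf : MemLp f 2 circleMeasure) :
    Tendsto (fourierCoeff f) cofinite (𝓝 0) := by
  have h := (hasSum_sq_fourierCoeff (hf.toLp f)).summable.tendsto_cofinite_zero
  simp only [fourierCoeff_toLp_two] at h
  rw [tendsto_zero_iff_norm_tendsto_zero]
  have := h.sqrt
  simpa using this

theorem Hardy.add {f g : UnitAddCircle → ℂ} (hf' : MemLp f 2 circleMeasure)
    (hg' : MemLp g 2 circleMeasure) (hf : Hardy f) (hg : Hardy g) :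
    Hardy (fun t => f t + g t) := fun n hn => by
  have := congrFun (fourierCoeff.add (hf'.integrable one_le_two) (hg'.integrable one_le_two)) n
  exact this.trans (by simp [hf n hn, hg n hn])

theorem fourierCoeff_sub {f g : UnitAddCircle → ℂ} (hf' : MemLp f 2 circleMeasure)
    (hg' : MemLp g 2 circleMeasure) (n : ℤ) :
    fourierCoeff (fun t => f t - g t) n = fourierCoeff f n - fourierCoeff g n := by
  have := congrFun (fourierCoeff.add (hf'.integrable one_le_two)
    (hg'.neg.integrable one_le_two)) n
  have h2 : fourierCoeff (-g) n = - fourierCoeff g n := by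
    have := fourierCoeff.const_smul g (-1) n
    simpa using this
  rw [Pi.add_apply, h2] at this
  rw [sub_eq_add_neg, ← this]
  simp only [sub_eq_add_neg]
  rfl

theorem Hardy.sub {f g : UnitAddCircle → ℂ} (hf' : MemLp f 2 circleMeasure)
    (hg' : MemLp g 2 circleMeasure) (hf : Hardy f) (hg : Hardy g) :
    Hardy (fun t => f t - g t) := fun n hn => by
  rw [fourierCoeff_sub hf' hg', hf n hn, hg n hn, sub_zero]

theorem Hardy.mul {f g : UnitAddCircle → ℂ} (hf' : MemLp f 2 circleMeasure)
    (hg' : MemLp g 2 circleMeasure) (hf : Hardy f) (hg : Hardy g) :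
    Hardy (fun t => f t * g t) := fun n hn =>
  fourierCoeff_mul_eq_zero hf' hg' fun k => by
    rcases lt_or_ge k 0 with h | h
    · exact Or.inr (hg k h)
    · exact Or.inl (hf _ (by omega))

/-- The product of the conjugate of an analytic function with an antianalytic function. -/
theorem Anti.conj_mul {f g : UnitAddCircle → ℂ} (hf' : MemLp f 2 circleMeasure)
    (hg' : MemLp g 2 circleMeasure) (hf : Hardy f) (hg : Anti g) :
    Anti (fun t => conj (f t) * g t) := fun n hn =>
  fourierCoeff_mul_eq_zero hf'.star hg' fun k => by
    rcases lt_or_ge k 0 with h | h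
    · left
      refine (fourierCoeff_conj f _).trans ?_
      rw [hf _ (by omega), map_zero]
    · exact Or.inr (hg k h)

/-! ### Polynomials on the circle -/

theorem norm_z (t : UnitAddCircle) : ‖(toCircle t : ℂ)‖ = 1 := Circle.norm_coe _

theorem memLp_of_continuous {f : UnitAddCircle → ℂ} (hf : Continuous f) (p : ℝ≥0∞) :
    MemLp f p circleMeasure :=
  (hf.memLp_top_of_hasCompactSupport (HasCompactSupport.of_compactSpace _) _).mono_exponent le_top

theorem continuous_circ (p : ℂ[X]) : Continuous (circ p) :=
  p.continuous.comp ((fourier (1 : ℤ)).continuous.congr fun _ => fourier_one)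

theorem memLp_circ (p : ℂ[X]) (q : ℝ≥0∞) : MemLp (circ p) q circleMeasure :=
  memLp_of_continuous (continuous_circ p) q

theorem memLp_top_mul {f g : UnitAddCircle → ℂ} {p : ℝ≥0∞} (hf : MemLp f ∞ circleMeasure)
    (hg : MemLp g p circleMeasure) : MemLp (fun t => f t * g t) p circleMeasure :=
  hg.mul hf

theorem memLp_circ_mul (p : ℂ[X]) {f : UnitAddCircle → ℂ} {q : ℝ≥0∞}
    (hf : MemLp f q circleMeasure) : MemLp (fun t => circ p t * f t) q circleMeasure :=
  memLp_top_mul (memLp_circ p ∞) hf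

theorem z_pow_eq_fourier (n : ℕ) (t : UnitAddCircle) :
    (toCircle t : ℂ) ^ n = fourier n t := by
  rw [fourier_apply, natCast_zsmul, AddCircle.toCircle_nsmul, Circle.coe_pow]

theorem fourierCoeff_circ_mul (p : ℂ[X]) {f : UnitAddCircle → ℂ} (hf : MemLp f 2 circleMeasure)
    {N : ℕ} (hN : p.natDegree < N) (n : ℤ) :
    fourierCoeff (fun t => circ p t * f t) n =
      ∑ i ∈ Finset.range N, p.coeff i * fourierCoeff f (n - i) := by
  have h1 : (fun t => circ p t * f t) =
      ∑ i ∈ Finset.range N, fun t => p.coeff i * ((fourier (i : ℤ) t : ℂ) * f t) := by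
    ext t
    rw [Finset.sum_apply, circ, eval_eq_sum_range' hN, Finset.sum_mul]
    refine Finset.sum_congr rfl fun i _ => ?_
    rw [z_pow_eq_fourier, mul_assoc]
  have hm : ∀ i : ℕ, MemLp (fun t => (fourier (i : ℤ) t : ℂ) * f t) 2 circleMeasure := fun i =>
    memLp_top_mul (memLp_of_continuous (map_continuous _) _) hf
  rw [h1, fourierCoeff.sum _ _ fun i _ => ((hm i).const_mul _).integrable one_le_two,
    Finset.sum_apply]
  refine Finset.sum_congr rfl fun i _ => ?_
  rw [fourierCoeff.const_mul, fourierCoeff_fourier_mul]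

theorem fourierCoeff_one (n : ℤ) :
    fourierCoeff (fun _ : UnitAddCircle => (1 : ℂ)) n = if n = 0 then 1 else 0 := by
  have : (fun _ : UnitAddCircle => (1 : ℂ)) = fourier (0 : ℤ) := by ext t; simp
  rw [this, fourierCoeff_fourier]
  simp [Pi.single_apply]

theorem fourierCoeff_circ (p : ℂ[X]) (n : ℤ) :
    fourierCoeff (circ p) n = if 0 ≤ n then p.coeff n.toNat else 0 := by
  have h := fourierCoeff_circ_mul p (memLp_of_continuous (continuous_const (y := (1 : ℂ))) 2)
    (N := max (p.natDegree + 1) (n.toNat + 1)) (by simp) n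
  simp only [mul_one, fourierCoeff_one] at h
  refine h.trans ?_
  split_ifs with h0
  · rw [Finset.sum_eq_single n.toNat]
    · simp [h0]
    · intro i _ hi
      rw [if_neg (by omega), mul_zero]
    · simp
  · exact Finset.sum_eq_zero fun i _ => by rw [if_neg (by omega), mul_zero]

theorem hardy_circ (p : ℂ[X]) : Hardy (circ p) := fun n hn => by
  rw [fourierCoeff_circ, if_neg (by omega)]

theorem Hardy.circ_mul (p : ℂ[X]) {f : UnitAddCircle → ℂ} (hf' : MemLp f 2 circleMeasure)
    (hf : Hardy f) : Hardy (fun t => circ p t * f t) :=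
  Hardy.mul (memLp_circ p 2) hf' (hardy_circ p) hf

theorem circ_eq_zero {p : ℂ[X]} (h : circ p =ᵐ[circleMeasure] 0) : p = 0 := by
  ext i
  have h1 := congrFun (fourierCoeff_congr_ae h) (i : ℤ)
  rw [fourierCoeff_circ, if_pos (by omega)] at h1
  simpa [fourierCoeff] using h1

/-! ### Dividing by polynomials -/

theorem fourierCoeff_X_sub_C_mul (c : ℂ) {f : UnitAddCircle → ℂ} (hf : MemLp f 2 circleMeasure)
    (n : ℤ) : fourierCoeff (fun t => circ (X - C c) t * f t) n =
      fourierCoeff f (n - 1) - c * fourierCoeff f n := by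
  rw [fourierCoeff_circ_mul _ hf (N := 2) (by simp)]
  simp [Finset.sum_range_succ, coeff_X, coeff_C]
  ring

/-- A square integrable quotient of an analytic function by a polynomial without zeros in the disk
is analytic. -/
theorem Hardy.of_X_sub_C_mul {c : ℂ} (hc : 1 ≤ ‖c‖) {f : UnitAddCircle → ℂ}
    (hf : MemLp f 2 circleMeasure) (h : Hardy fun t => circ (X - C c) t * f t) : Hardy f := by
  intro n hn
  -- Going left from n < 0 multiplies the coefficient by c each time. As |c| ≥ 1 the moduli do not
  -- decrease, yet they tend to 0.
  have h1 : ∀ k : ℕ, fourierCoeff f (n - k) = c ^ k * fourierCoeff f n := by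
    intro k
    induction k with
    | zero => simp
    | succ k ih =>
      have h2 := h (n - k) (by omega)
      rw [fourierCoeff_X_sub_C_mul c hf, ih] at h2
      push_cast
      rw [← sub_sub, sub_eq_zero.1 h2]; ring
  have h3 : Tendsto (fun k : ℕ => fourierCoeff f (n - k)) atTop (𝓝 0) := by
    refine (tendsto_fourierCoeff hf).comp ?_
    rw [← Nat.cofinite_eq_atTop]
    exact Function.Injective.tendsto_cofinite fun a b hab => by simpa using hab
  have h4 : ∀ k : ℕ, ‖fourierCoeff f n‖ ≤ ‖fourierCoeff f (n - k)‖ := fun k => by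
    rw [h1, norm_mul, norm_pow]
    exact le_mul_of_one_le_left (norm_nonneg _) (one_le_pow₀ hc)
  have h5 := ge_of_tendsto' h3.norm h4
  simpa using h5

/-- Linear factors with a root outside the open disk are cancelled one at a time. -/
theorem Hardy.exists_circ_mul {P : ℂ[X]} (hP : P ≠ 0) {f : UnitAddCircle → ℂ}
    (hf : MemLp f 2 circleMeasure) (h : Hardy fun t => circ P t * f t) :
    ∃ Q : ℂ[X], Q ∣ P ∧ (∀ z, Q.eval z = 0 → ‖z‖ < 1) ∧ Hardy fun t => circ Q t * f t := by
  induction hd : P.natDegree generalizing P with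
  | zero =>
    refine ⟨P, dvd_rfl, fun z hz => ?_, h⟩
    rw [eq_C_of_natDegree_eq_zero hd] at hz hP
    simp at hz
    simp [hz] at hP
  | succ d ih =>
    by_cases hr : ∀ z, P.eval z = 0 → ‖z‖ < 1
    · exact ⟨P, dvd_rfl, hr, h⟩
    push Not at hr
    obtain ⟨c, hc, hc1⟩ := hr
    obtain ⟨Q, rfl⟩ := dvd_iff_isRoot.2 hc
    have hQ : Q ≠ 0 := right_ne_zero_of_mul hP
    have h2 : Hardy fun t => circ Q t * f t := by
      refine Hardy.of_X_sub_C_mul hc1 (memLp_circ_mul Q hf) (h.congr (Eventually.of_forall ?_))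
      intro t
      simp only [circ, eval_mul]; ring
    rw [natDegree_mul (X_sub_C_ne_zero c) hQ, natDegree_X_sub_C] at hd
    obtain ⟨R, hR, h3⟩ := ih hQ h2 (by omega)
    exact ⟨R, hR.mul_left _, h3⟩

theorem Hardy.of_circ_mul {P : ℂ[X]} (hP : P ≠ 0) (hr : ∀ z, P.eval z = 0 → 1 ≤ ‖z‖)
    {f : UnitAddCircle → ℂ} (hf : MemLp f 2 circleMeasure)
    (h : Hardy fun t => circ P t * f t) : Hardy f := by
  obtain ⟨Q, hQ, hQr, hQf⟩ := Hardy.exists_circ_mul hP hf h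
  have hd : Q.degree = 0 := by
    by_contra hd
    obtain ⟨z, hz⟩ := IsAlgClosed.exists_root Q hd
    have h1 := hQr z hz
    have h2 := hr z (eval_eq_zero_of_dvd_of_eval_eq_zero hQ hz)
    linarith
  rw [eq_C_of_degree_eq_zero hd] at hQf
  have hc : Q.coeff 0 ≠ 0 := by
    intro h0
    rw [eq_C_of_degree_eq_zero hd, h0] at hd
    simp at hd
  intro n hn
  have := hQf n hn
  simp only [circ, eval_C] at this
  rw [fourierCoeff.const_mul] at this
  exact (mul_eq_zero.1 this).resolve_left hc

/-- An antianalytic part is determined by as many coefficients as the degree of a polynomial that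
multiplies the function into the analytic ones. -/
theorem Hardy.of_circ_mul_of_coeff {P : ℂ[X]} (hP : P ≠ 0) {f : UnitAddCircle → ℂ}
    (hf : MemLp f 2 circleMeasure) (h : Hardy fun t => circ P t * f t)
    (h0 : ∀ j : ℕ, j < P.natDegree → fourierCoeff f (-1 - j) = 0) : Hardy f := by
  have key : ∀ j : ℕ, fourierCoeff f (-1 - j) = 0 := by
    intro j
    induction j using Nat.strong_induction_on with
    | _ j ih =>
      rcases lt_or_ge j P.natDegree with hj | hj
      · exact h0 j hj
      -- In this coefficient of Pf, the leading term of P meets f̂(−1 − j) and all lower terms meet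
      -- coefficients already known to vanish.
      have h1 := h (-1 - j + P.natDegree) (by omega)
      rw [fourierCoeff_circ_mul P hf (Nat.lt_succ_self _), Finset.sum_range_succ,
        Finset.sum_eq_zero, zero_add, add_sub_cancel_right] at h1
      · exact (mul_eq_zero.1 h1).resolve_left (leadingCoeff_ne_zero.2 hP)
      · intro i hi
        have hi := Finset.mem_range.1 hi
        have := ih (j + i - P.natDegree) (by omega)
        rw [Nat.cast_sub (by omega)] at this
        push_cast at this
        rw [show (-1 - (j:ℤ) + P.natDegree - i) = -1 - (j + i - P.natDegree) by ring, this, mul_zero]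
  intro n hn
  have := key (-1 - n).toNat
  rwa [Int.toNat_of_nonneg (by omega), sub_sub_cancel] at this

theorem conj_z_mul_z (t : UnitAddCircle) : conj (toCircle t : ℂ) * (toCircle t : ℂ) = 1 := by
  rw [Complex.conj_mul', norm_z]; simp

theorem fourier_neg_one (t : UnitAddCircle) :
    (fourier (-1) t : ℂ) = conj (toCircle t : ℂ) := by
  rw [fourier_neg, fourier_one]

theorem circ_ne_zero {p : ℂ[X]} (hp : p ≠ 0) : ∀ᵐ t ∂circleMeasure, circ p t ≠ 0 := by
  have hfin : {t : UnitAddCircle | circ p t = 0}.Finite := by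
    have h1 : (p.rootSet ℂ).Finite := p.rootSet_finite ℂ
    refine (h1.preimage (f := fun t : UnitAddCircle => (toCircle t : ℂ)) ?_).subset ?_
    · exact (Circle.coe_injective.comp (AddCircle.injective_toCircle one_ne_zero)).injOn
    · intro t ht
      simpa [mem_rootSet, hp, circ] using ht
  have : Nontrivial UnitAddCircle :=
    ⟨0, ((1 / 2 : ℝ) : UnitAddCircle), fun h => by
      have h1 := (AddCircle.coe_eq_zero_iff_of_mem_Ico (p := (1 : ℝ))
        (show (1 / 2 : ℝ) ∈ Set.Ico (0 : ℝ) 1 by norm_num)).1 h.symm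
      norm_num at h1⟩
  have : (𝓝[≠] (0 : UnitAddCircle)).NeBot :=
    ConnectedSpace.neBot_nhdsWithin_compl_of_nontrivial_of_t1space 0
  have : NullSingletonClass (haarAddCircle : Measure UnitAddCircle) := inferInstance
  rw [ae_iff]
  simpa using hfin.measure_zero circleMeasure

theorem Hardy.ae_eq_zero {f : UnitAddCircle → ℂ} (hf' : MemLp f 2 circleMeasure) (hf : Hardy f)
    (h : Anti f) : f =ᵐ[circleMeasure] 0 :=
  ae_eq_zero_of_fourierCoeff hf' fun n => by
    rcases lt_or_ge n 0 with hn | hn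
    · exact hf n hn
    · exact h n hn

theorem exists_circ_sub_anti {f : UnitAddCircle → ℂ} (hf : MemLp f 2 circleMeasure) {N : ℕ}
    (h : ∀ n : ℤ, N ≤ n → fourierCoeff f n = 0) :
    ∃ p : ℂ[X], p.degree < N ∧ Anti fun t => f t - circ p t := by
  refine ⟨∑ i ∈ Finset.range N, monomial i (fourierCoeff f i), ?_, fun n hn => ?_⟩
  · refine (degree_sum_le _ _).trans_lt ((Finset.sup_lt_iff (WithBot.bot_lt_coe N)).2 ?_)
    intro i hi
    exact (degree_monomial_le _ _).trans_lt (Nat.cast_lt.2 (Finset.mem_range.1 hi))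
  · rw [fourierCoeff_sub hf (memLp_circ _ 2), fourierCoeff_circ, if_pos hn, finsetSum_coeff]
    simp only [coeff_monomial, Finset.sum_ite_eq', Finset.mem_range, Int.toNat_of_nonneg hn]
    split_ifs with h1
    · simp
    · rw [h n (by omega), sub_zero]

theorem exists_hardy_sub_anti {f : UnitAddCircle → ℂ} (hf : MemLp f 2 circleMeasure) :
    ∃ u : UnitAddCircle → ℂ, MemLp u 2 circleMeasure ∧ Hardy u ∧ Anti fun t => f t - u t := by
  have : CompleteSpace H2 := isClosed_H2.completeSpace_coe
  refine ⟨H2.starProjection (hf.toLp f), Lp.memLp _, (H2.starProjection_apply_mem _ :), ?_⟩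
  intro n hn
  rw [fourierCoeff_sub hf (Lp.memLp _), ← fourierCoeff_toLp_two hf, ← inner_fourierBasis,
    ← inner_fourierBasis, ← inner_sub_right, ← inner_conj_symm]
  rw [Submodule.starProjection_inner_eq_zero, map_zero]
  intro m hm
  rw [← inner_fourierBasis, orthonormal_iff_ite.1 (fourierBasis (T := 1)).orthonormal,
    if_neg (by omega)]

/-- A bounded function that a nonzero polynomial multiplies into the analytic functions is the sum
of an analytic and a rational one. -/
theorem exists_rational_of_circ_mul {P : ℂ[X]} (hP : P ≠ 0) {f : UnitAddCircle → ℂ}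
    (hf : MemLp f 2 circleMeasure) (h : Hardy fun t => circ P t * f t) :
    ∃ R Q : ℂ[X], (∀ z, Q.eval z = 0 → ‖z‖ < 1) ∧ Hardy fun t => f t - circ R t / circ Q t := by
  obtain ⟨Q, hQP, hQ, hQf⟩ := Hardy.exists_circ_mul hP hf h
  obtain ⟨u, hu', hu, hfu⟩ := exists_hardy_sub_anti hf
  have hv' : MemLp (fun t => f t - u t) 2 circleMeasure := hf.sub hu'
  have hw' := memLp_circ_mul Q hv'
  -- As f − u is antianalytic, Q(f − u) has no coefficient of index deg Q or more. Removing its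
  -- analytic part R leaves a function that is analytic and antianalytic, hence zero; so f − R/Q =
  -- u.
  obtain ⟨R, -, hR⟩ := exists_circ_sub_anti (N := Q.natDegree) hw' fun n hn => by
    rw [fourierCoeff_circ_mul Q hv' (Nat.lt_succ_self _)]
    refine Finset.sum_eq_zero fun i hi => ?_
    have := Finset.mem_range.1 hi
    rw [hfu _ (by omega), mul_zero]
  have h1 : Hardy fun t => circ Q t * (f t - u t) - circ R t := by
    refine Hardy.sub hw' (memLp_circ R 2) ?_ (hardy_circ R)
    refine (Hardy.sub (memLp_circ_mul Q hf) (memLp_circ_mul Q hu') hQf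
      (hu.circ_mul Q hu')).congr (Eventually.of_forall fun t => ?_)
    simp only; ring
  have h2 := Hardy.ae_eq_zero (hw'.sub (memLp_circ R 2)) h1 hR
  refine ⟨R, Q, hQ, hu.congr ?_⟩
  filter_upwards [h2] with t ht
  have hne : circ Q t ≠ 0 := fun h0 => by
    have := hQ _ h0
    rw [norm_z] at this
    exact lt_irrefl _ this
  have ht' : circ Q t * (f t - u t) - circ R t = 0 := ht
  field_simp
  linear_combination -ht'

/-! ### Elimination of θ -/

/-- The polynomial `z ^ n * conj a` on the circle. -/
theorem exists_circ_eq_conj (a : ℂ[X]) {n : ℕ} (hn : a.natDegree ≤ n) :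
    ∃ a' : ℂ[X], a'.natDegree ≤ n ∧
      ∀ t, circ a' t = (toCircle t : ℂ) ^ n * conj (circ a t) := by
  refine ⟨∑ i ∈ Finset.range (n + 1), C (conj (a.coeff i)) * X ^ (n - i), ?_, fun t => ?_⟩
  · exact natDegree_sum_le_of_forall_le _ _ fun i _ =>
      (natDegree_C_mul_X_pow_le _ _).trans (Nat.sub_le _ _)
  · simp only [circ]
    rw [eval_eq_sum_range' (Nat.lt_succ_of_le hn) (p := a), map_sum, Finset.mul_sum,
      eval_finsetSum]
    refine Finset.sum_congr rfl fun i hi => ?_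
    have hi := Finset.mem_range.1 hi
    have h1 : (toCircle t : ℂ) ^ n = (toCircle t : ℂ) ^ (n - i) * (toCircle t : ℂ) ^ i := by
      rw [← pow_add]; congr 1; omega
    have h2 : conj (toCircle t : ℂ) ^ i * (toCircle t : ℂ) ^ i = 1 := by
      rw [← mul_pow, conj_z_mul_z, one_pow]
    simp only [eval_mul, eval_C, eval_pow, eval_X, map_mul, map_pow, h1]
    linear_combination (-(conj (a.coeff i)) * (toCircle t : ℂ) ^ (n - i)) * h2

theorem conj_mul_self_of_norm {x : ℂ} (h : ‖x‖ = 1) : conj x * x = 1 := by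
  rw [Complex.conj_mul', h]; simp

/-- The elimination of `θ` from `a - b θ` and its image under the conjugation of the model space. -/
theorem exists_circ_mul_hardy {θ ψ : UnitAddCircle → ℂ} (hθ' : MemLp θ ∞ circleMeasure)
    (hθ : ∀ᵐ t ∂circleMeasure, ‖θ t‖ = 1) (hψ : MemLp ψ ∞ circleMeasure) {a b : ℂ[X]} {n : ℕ}
    (ha : a.natDegree ≤ n) (hb : b.natDegree ≤ n)
    (hanti : Anti fun t => conj (θ t) * (circ a t - circ b t * θ t))
    (hne : ¬ (fun t => circ a t - circ b t * θ t) =ᵐ[circleMeasure] 0)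
    (h1 : Hardy fun t => ψ t * (circ a t - circ b t * θ t))
    (h2 : Hardy fun t => ψ t *
      (conj (toCircle t : ℂ) * (conj (circ a t) * θ t - conj (circ b t)))) :
    ∃ P : ℂ[X], P ≠ 0 ∧ P.natDegree ≤ 2 * n ∧ Hardy fun t => circ P t * ψ t := by
  obtain ⟨a', ha', haz⟩ := exists_circ_eq_conj a ha
  obtain ⟨b', hb', hbz⟩ := exists_circ_eq_conj b hb
  have hconj : ∀ {f : UnitAddCircle → ℂ} {p : ℝ≥0∞}, MemLp f p circleMeasure →
    MemLp (fun t => conj (f t)) p circleMeasure := fun hf => hf.star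
  have hg : MemLp (fun t => circ a t - circ b t * θ t) ∞ circleMeasure :=
    (memLp_circ a _).sub (memLp_circ_mul b hθ')
  have hg' : MemLp (fun t => conj (toCircle t : ℂ) *
      (conj (circ a t) * θ t - conj (circ b t))) ∞ circleMeasure := by
    refine memLp_top_mul ?_ ((memLp_top_mul (hconj (memLp_circ a _)) hθ').sub
      (hconj (memLp_circ b _)))
    exact (hconj (memLp_circ X ∞)).ae_eq (Eventually.of_forall fun t => by simp [circ])
  -- On the circle this polynomial is zⁿ(|a|² − |b|²).
  refine ⟨a * a' - b * b', ?_, ?_, ?_⟩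
  · intro hP
    apply hne
    -- If |a| = |b| on the circle, then g = a − bθ satisfies |g|² = −2 Re(conj(b)·conj(θ)g). The
    -- function on the right is antianalytic before taking real parts, so it has mean zero, and g =
    -- 0.
    have hw := Anti.conj_mul (memLp_circ b 2)
      ((memLp_top_mul (hconj hθ') hg).mono_exponent le_top) (hardy_circ b) hanti
    have hwm : MemLp (fun t => conj (circ b t) * (conj (θ t) *
        (circ a t - circ b t * θ t))) ∞ circleMeasure :=
      memLp_top_mul (hconj (memLp_circ b _)) (memLp_top_mul (hconj hθ') hg)
    have hw0 := hw 0 le_rfl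
    simp only [fourierCoeff, neg_zero, fourier_zero, one_smul] at hw0
    have hint : ∫ t, ((‖circ a t - circ b t * θ t‖ ^ 2 : ℝ) : ℂ) ∂circleMeasure = 0 := by
      have e : (fun t => ((‖circ a t - circ b t * θ t‖ ^ 2 : ℝ) : ℂ)) =ᵐ[circleMeasure]
          fun t => -(conj (circ b t) * (conj (θ t) * (circ a t - circ b t * θ t))
            + conj (conj (circ b t) * (conj (θ t) * (circ a t - circ b t * θ t)))) := by
        filter_upwards [hθ] with t ht
        have h3 : circ a t * circ a' t = circ b t * circ b' t := by
          have := congrArg (fun p => circ p t) hP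
          simp only [circ, eval_sub, eval_mul, eval_zero] at this ⊢
          exact sub_eq_zero.1 this
        rw [haz, hbz] at h3
        have h4 : circ a t * conj (circ a t) = circ b t * conj (circ b t) := by
          have hz : (toCircle t : ℂ) ^ n ≠ 0 := pow_ne_zero _ (Circle.coe_ne_zero _)
          exact mul_left_cancel₀ hz (by linear_combination h3)
        have h5 := conj_mul_self_of_norm ht
        push_cast
        rw [← Complex.conj_mul']
        simp only [map_sub, map_mul, RCLike.conj_conj]
        linear_combination h4 - circ b t * conj (circ b t) * h5
      rw [integral_congr_ae e, integral_neg, integral_add, integral_conj, hw0]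
      · simp
      · exact (hwm.integrable le_top)
      · exact ((hconj hwm).integrable le_top)
    rw [integral_complex_ofReal, Complex.ofReal_eq_zero,
      integral_eq_zero_iff_of_nonneg (fun t => by positivity)] at hint
    · filter_upwards [hint] with t ht
      simpa using ht
    · exact (hg.mono_exponent le_top).integrable_norm_pow (p := 2) two_ne_zero
  · refine (natDegree_sub_le _ _).trans (max_le ?_ ?_) <;>
      exact natDegree_mul_le.trans (by omega)
  -- The combination a'g + z^(n+1) b·Cg cancels the terms containing θ.
  · have hs := Hardy.add (memLp_circ_mul a' ((memLp_top_mul hψ hg).mono_exponent le_top))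
      (memLp_circ_mul (b * X ^ (n + 1)) ((memLp_top_mul hψ hg').mono_exponent le_top))
      (h1.circ_mul a' ((memLp_top_mul hψ hg).mono_exponent le_top))
      (h2.circ_mul (b * X ^ (n + 1)) ((memLp_top_mul hψ hg').mono_exponent le_top))
    refine hs.congr (Eventually.of_forall fun t => ?_)
    have hP : circ (a * a' - b * b') t = circ a t * circ a' t - circ b t * circ b' t := by
      simp [circ]
    have hb2 : circ (b * X ^ (n + 1)) t = circ b t * (toCircle t : ℂ) ^ (n + 1) := by
      simp [circ]
    have hz := conj_z_mul_z t
    simp only [hP, hb2, haz, hbz]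
    linear_combination (ψ t * circ b t * (toCircle t : ℂ) ^ n *
      (conj (circ a t) * θ t - conj (circ b t))) * hz

/-! ### Rational inner functions are finite Blaschke products -/

theorem exists_disk_factorization {a : ℂ[X]} (ha : a ≠ 0) :
    ∃ (n : ℕ) (μ : Fin n → ℂ) (a' : ℂ[X]), (∀ i, ‖μ i‖ < 1) ∧ a = (∏ i, (X - C (μ i))) * a' ∧
      ∀ z, a'.eval z = 0 → 1 ≤ ‖z‖ := by
  induction hd : a.natDegree generalizing a with
  | zero =>
    refine ⟨0, Fin.elim0, a, fun i => i.elim0, by simp, fun z hz => ?_⟩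
    rw [eq_C_of_natDegree_eq_zero hd] at hz ha
    simp at hz
    simp [hz] at ha
  | succ d ih =>
    by_cases hr : ∀ z, a.eval z = 0 → 1 ≤ ‖z‖
    · exact ⟨0, Fin.elim0, a, fun i => i.elim0, by simp, hr⟩
    push Not at hr
    obtain ⟨c, hc, hc1⟩ := hr
    obtain ⟨Q, rfl⟩ := dvd_iff_isRoot.2 hc
    have hQ : Q ≠ 0 := right_ne_zero_of_mul ha
    rw [natDegree_mul (X_sub_C_ne_zero c) hQ, natDegree_X_sub_C] at hd
    obtain ⟨n, μ, a', hμ, h1, h2⟩ := ih hQ (by omega)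
    refine ⟨n + 1, Fin.cons c μ, a', fun i => ?_, ?_, h2⟩
    · refine Fin.cases hc1 (fun j => ?_) i
      simpa using hμ j
    · rw [Fin.prod_univ_succ]
      simp only [Fin.cons_zero, Fin.cons_succ, mul_assoc]
      rw [← h1]

theorem one_sub_conj_mul_ne_zero {μ z : ℂ} (hμ : ‖μ‖ < 1) (hz : ‖z‖ ≤ 1) :
    1 - conj μ * z ≠ 0 := by
  intro h
  have h1 : ‖conj μ * z‖ = 1 := by rw [← sub_eq_zero.1 h, norm_one]
  rw [norm_mul, RCLike.norm_conj] at h1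
  nlinarith [norm_nonneg μ, norm_nonneg z]

theorem norm_sub_eq_norm_one_sub (μ : ℂ) {z : ℂ} (hz : ‖z‖ = 1) :
    ‖z - μ‖ = ‖1 - conj μ * z‖ := by
  have h := conj_mul_self_of_norm hz
  have : 1 - conj μ * z = z * conj (z - μ) := by
    rw [map_sub]; linear_combination -h
  rw [this, norm_mul, hz, one_mul, RCLike.norm_conj]

theorem exists_const_of_hardy_conj {F : UnitAddCircle → ℂ} (hF : MemLp F 2 circleMeasure)
    (h1 : Hardy F) (h2 : Hardy fun t => conj (F t)) :
    ∃ c : ℂ, F =ᵐ[circleMeasure] fun _ => c := by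
  refine ⟨fourierCoeff F 0, ?_⟩
  have hc : MemLp (fun _ : UnitAddCircle => fourierCoeff F 0 * 1) 2 circleMeasure :=
    memLp_of_continuous continuous_const 2
  have h := ae_eq_zero_of_fourierCoeff (hF.sub hc) fun n => by
    refine (fourierCoeff_sub hF hc n).trans ?_
    rw [fourierCoeff.const_mul, fourierCoeff_one]
    rcases lt_trichotomy n 0 with hn | rfl | hn
    · rw [h1 n hn, if_neg hn.ne]; simp
    · simp
    · have := h2 (-n) (by omega)
      rw [fourierCoeff_conj, neg_neg, map_eq_zero] at this
      rw [this, if_neg hn.ne']; simp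
  filter_upwards [h] with t ht
  simpa [sub_eq_zero] using ht

/-- An inner function that is a quotient of two polynomials is a finite Blaschke product. -/
theorem isFiniteBlaschke_of_circ_mul {θ : LInf} (hθ : IsInner θ) {a b : ℂ[X]} (hb : b ≠ 0)
    (hab : circ a =ᵐ[circleMeasure] fun t => circ b t * θ t) : IsFiniteBlaschke θ := by
  have hθ2 : MemLp θ 2 circleMeasure := (Lp.memLp θ).mono_exponent le_top
  have hθH : Hardy θ := hθ.1
  wlog hcop : IsCoprime a b generalizing a b
  · have hd : EuclideanDomain.gcd a b ≠ 0 := fun h => hb (EuclideanDomain.gcd_eq_zero_iff.1 h).2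
    obtain ⟨a₁, ha₁⟩ := EuclideanDomain.gcd_dvd_left a b
    obtain ⟨b₁, hb₁⟩ := EuclideanDomain.gcd_dvd_right a b
    have hg := EuclideanDomain.gcd_eq_gcd_ab a b
    set d := EuclideanDomain.gcd a b with hd'
    refine this (a := a₁) (b := b₁) ?_ ?_ ?_
    · rintro rfl; simp at hb₁; exact hb hb₁
    · filter_upwards [hab, circ_ne_zero hd] with t h1 h2
      rw [ha₁, hb₁] at h1
      simp only [circ, eval_mul] at h1 h2 ⊢
      exact mul_left_cancel₀ h2 (by linear_combination h1)
    · refine ⟨EuclideanDomain.gcdA a b, EuclideanDomain.gcdB a b, mul_left_cancel₀ hd ?_⟩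
      linear_combination (-(EuclideanDomain.gcdA a b)) * ha₁ -
        (EuclideanDomain.gcdB a b) * hb₁ - hg
  obtain ⟨u, v, huv⟩ := hcop
  have hbr : ∀ z, b.eval z = 0 → 1 ≤ ‖z‖ := by
    intro c hc
    by_contra! hc1
    obtain ⟨b₁, rfl⟩ := dvd_iff_isRoot.2 hc
    -- From ua + vb = 1 and a = bθ follows b(uθ + v) = 1, so E is an analytic inverse of z − c. For
    -- |c| < 1 this is impossible: Ê(0) = cᵏÊ(k) → 0, while the constant coefficient of (z − c)E
    -- forces −cÊ(0) = 1.
    set E : UnitAddCircle → ℂ := fun t => circ b₁ t * (circ u t * θ t + circ v t) with hE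
    have hG' : MemLp (fun t => circ u t * θ t + circ v t) 2 circleMeasure :=
      (memLp_circ_mul u hθ2).add (memLp_circ v 2)
    have hE' : MemLp E 2 circleMeasure := memLp_circ_mul b₁ hG'
    have hEH : Hardy E := Hardy.circ_mul b₁ hG'
      (Hardy.add (memLp_circ_mul u hθ2) (memLp_circ v 2) (hθH.circ_mul u hθ2) (hardy_circ v))
    have h1 : (fun t => circ (X - C c) t * E t) =ᵐ[circleMeasure] fun _ => 1 := by
      filter_upwards [hab] with t ht
      have h2 : circ u t * circ a t + circ v t * (circ (X - C c) t * circ b₁ t) = 1 := by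
        have := congrArg (fun p => circ p t) huv
        simpa only [circ, eval_add, eval_mul, eval_one] using this
      have h3 : circ ((X - C c) * b₁) t = circ (X - C c) t * circ b₁ t := by simp [circ]
      rw [h3] at ht
      rw [hE, ← h2, ht]; ring
    have h2 : ∀ n : ℤ, fourierCoeff E (n - 1) - c * fourierCoeff E n = if n = 0 then 1 else 0 := by
      intro n
      rw [← fourierCoeff_X_sub_C_mul c hE', fourierCoeff_congr_ae h1, fourierCoeff_one]
    have h3 : ∀ k : ℕ, fourierCoeff E 0 = c ^ k * fourierCoeff E k := by
      intro k
      induction k with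
      | zero => simp
      | succ k ih =>
        have := h2 (k + 1)
        rw [if_neg (by omega), add_sub_cancel_right] at this
        rw [ih, sub_eq_zero.1 this]; push_cast; ring
    have h4 : Tendsto (fun k : ℕ => c ^ k * fourierCoeff E k) atTop (𝓝 (0 * 0)) := by
      refine (tendsto_pow_atTop_nhds_zero_of_norm_lt_one hc1).mul
        ((tendsto_fourierCoeff hE').comp ?_)
      rw [← Nat.cofinite_eq_atTop]
      exact Nat.cast_injective.tendsto_cofinite
    have h5 : fourierCoeff E 0 = 0 := by
      have h6 : (fun k : ℕ => c ^ k * fourierCoeff E k) = fun _ => fourierCoeff E 0 :=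
        funext fun k => (h3 k).symm
      rw [h6, mul_zero] at h4
      exact tendsto_nhds_unique tendsto_const_nhds h4
    have h7 := h2 0
    rw [h5, hEH _ (by omega)] at h7
    simp at h7
  have ha : a ≠ 0 := by
    rintro rfl
    refine hb (circ_eq_zero ?_)
    filter_upwards [hab, hθ.2] with t h1 h2
    have h3 : θ t ≠ 0 := fun h => by simp [h] at h2
    have : circ b t * θ t = 0 := by rw [← h1]; simp [circ]
    exact (mul_eq_zero.1 this).resolve_right h3
  obtain ⟨n, μ, a₂, hμ, ha₂, ha₂r⟩ := exists_disk_factorization ha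
  set A := ∏ i, (X - C (μ i)) with hA
  set A' := ∏ i, (1 - C (conj (μ i)) * X) with hA'
  have hAe : ∀ t, circ A t = ∏ i, ((toCircle t : ℂ) - μ i) := fun t => by
    simp [circ, hA, eval_prod]
  have hAe' : ∀ t, circ A' t = ∏ i, (1 - conj (μ i) * (toCircle t : ℂ)) := fun t => by
    simp [circ, hA', eval_prod]
  have hA0 : ∀ t, circ A' t ≠ 0 := fun t => by
    rw [hAe']
    exact Finset.prod_ne_zero_iff.2 fun i _ => one_sub_conj_mul_ne_zero (hμ i) (norm_z t).le
  have hnorm : ∀ t, ‖circ A t‖ = ‖circ A' t‖ := fun t => by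
    rw [hAe, hAe', norm_prod, norm_prod]
    exact Finset.prod_congr rfl fun i _ => norm_sub_eq_norm_one_sub _ (norm_z t)
  have hA0' : ∀ t, circ A t ≠ 0 := fun t => by
    rw [← norm_ne_zero_iff, hnorm, norm_ne_zero_iff]; exact hA0 t
  -- F is θ divided by the Blaschke product of the zeros of a in the disk. Both bF = a₂A' and
  -- a₂A'·conj F = b hold with multipliers free of zeros in the disk, so F and conj F are analytic
  -- and F is constant.
  set F : UnitAddCircle → ℂ := fun t => (circ A' t / circ A t) * θ t with hF
  have hF' : MemLp F 2 circleMeasure :=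
    memLp_top_mul (memLp_of_continuous ((continuous_circ A').div (continuous_circ A) hA0') _) hθ2
  have hF1 : ∀ᵐ t ∂circleMeasure, ‖F t‖ = 1 := by
    filter_upwards [hθ.2] with t ht
    rw [hF]
    simp only [norm_mul, norm_div, hnorm, ht, mul_one]
    exact div_self (norm_ne_zero_iff.2 (hA0 t))
  have hbF : (fun t => circ b t * F t) =ᵐ[circleMeasure] circ (a₂ * A') := by
    filter_upwards [hab] with t ht
    have h1 : circ a t = circ A t * circ a₂ t := by rw [ha₂]; simp [circ]
    have h2 : circ (a₂ * A') t = circ a₂ t * circ A' t := by simp [circ]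
    have h3 := hA0' t
    rw [h2, hF]
    field_simp
    rw [h1] at ht
    linear_combination (-circ A' t) * ht
  have hFH : Hardy F := Hardy.of_circ_mul hb hbr hF' ((hardy_circ _).congr hbF.symm)
  have hFc : Hardy fun t => conj (F t) := by
    have h0 : a₂ * A' ≠ 0 := by
      refine mul_ne_zero (right_ne_zero_of_mul (ha₂ ▸ ha)) fun h => hA0 0 ?_
      rw [h]; simp [circ]
    refine Hardy.of_circ_mul h0 (fun z hz => ?_) hF'.star ((hardy_circ b).congr ?_)
    · rw [eval_mul] at hz
      rcases mul_eq_zero.1 hz with hz | hz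
      · exact ha₂r z hz
      · by_contra! hz1
        rw [hA', eval_prod] at hz
        obtain ⟨i, -, hi⟩ := Finset.prod_eq_zero_iff.1 hz
        simp only [eval_sub, eval_one, eval_mul, eval_C, eval_X] at hi
        exact one_sub_conj_mul_ne_zero (hμ i) hz1.le hi
    · filter_upwards [hbF, hF1] with t h1 h2
      have h3 := conj_mul_self_of_norm h2
      rw [← h1]
      linear_combination (-circ b t) * h3
  obtain ⟨c, hc⟩ := exists_const_of_hardy_conj hF' hFH hFc
  refine ⟨n, μ, c, hμ, ?_, ?_⟩
  · obtain ⟨t, h1, h2⟩ := (hF1.and hc).exists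
    exact (congrArg norm h2).symm.trans h1
  · filter_upwards [hc] with t ht
    rw [Finset.prod_div_distrib, ← hAe, ← hAe', ← ht, hF]
    have h1 := hA0 t
    have h2 := hA0' t
    field_simp

theorem IsFiniteBlaschke.exists_circ {θ : LInf} (h : IsFiniteBlaschke θ) :
    ∃ p q : ℂ[X], p ≠ 0 ∧ (fun t => circ q t * θ t) =ᵐ[circleMeasure] circ p := by
  obtain ⟨n, μ, c, hμ, hc, h⟩ := h
  refine ⟨C c * ∏ i, (X - C (μ i)), ∏ i, (1 - C (conj (μ i)) * X), ?_, ?_⟩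
  · refine mul_ne_zero (fun h0 => ?_) (Finset.prod_ne_zero_iff.2 fun i _ => X_sub_C_ne_zero _)
    rw [C_eq_zero.1 h0] at hc
    simp at hc
  · filter_upwards [h] with t ht
    rw [ht]
    simp only [circ, eval_mul, eval_prod, eval_C, eval_sub, eval_one, eval_X,
      Finset.prod_div_distrib]
    have h0 : ∏ i, (1 - conj (μ i) * (toCircle t : ℂ)) ≠ 0 :=
      Finset.prod_ne_zero_iff.2 fun i _ => one_sub_conj_mul_ne_zero (hμ i) (norm_z t).le
    rw [mul_left_comm, mul_div_cancel₀ _ h0]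

/-! ### The kernel of the operator -/

theorem fourierCoeff_conj_z_mul_conj (f : UnitAddCircle → ℂ) (n : ℤ) :
    fourierCoeff (fun t => conj (toCircle t : ℂ) * conj (f t)) n =
      conj (fourierCoeff f (-n - 1)) := by
  simp only [← fourier_neg_one]
  rw [fourierCoeff_fourier_mul, fourierCoeff_conj]
  congr 2; ring

theorem hardy_conj_z_mul_conj {f : UnitAddCircle → ℂ} :
    Hardy (fun t => conj (toCircle t : ℂ) * conj (f t)) ↔ Anti f := by
  refine ⟨fun h n hn => ?_, fun h n hn => ?_⟩
  · have := h (-n - 1) (by omega)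
    rw [fourierCoeff_conj_z_mul_conj, map_eq_zero] at this
    rwa [show -(-n - 1) - 1 = n by ring] at this
  · rw [fourierCoeff_conj_z_mul_conj, h _ (by omega), map_zero]

theorem anti_conj_z_mul_conj {f : UnitAddCircle → ℂ} :
    Anti (fun t => conj (toCircle t : ℂ) * conj (f t)) ↔ Hardy f := by
  refine ⟨fun h n hn => ?_, fun h n hn => ?_⟩
  · have := h (-n - 1) (by omega)
    rw [fourierCoeff_conj_z_mul_conj, map_eq_zero] at this
    rwa [show -(-n - 1) - 1 = n by ring] at this
  · rw [fourierCoeff_conj_z_mul_conj, h _ (by omega), map_zero]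

theorem fourierCoeff_conj_z_mul_neg (f : UnitAddCircle → ℂ) (n : ℤ) :
    fourierCoeff (fun t => conj (toCircle t : ℂ) * f (-t)) n = fourierCoeff f (-n - 1) := by
  simp only [← fourier_neg_one]
  rw [fourierCoeff_fourier_mul, fourierCoeff_comp_neg]
  congr 1; ring

theorem hardy_conj_z_mul_neg {f : UnitAddCircle → ℂ} :
    Hardy (fun t => conj (toCircle t : ℂ) * f (-t)) ↔ Anti f := by
  refine ⟨fun h n hn => ?_, fun h n hn => ?_⟩
  · have := h (-n - 1) (by omega)
    rwa [fourierCoeff_conj_z_mul_neg, show -(-n - 1) - 1 = n by ring] at this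
  · rw [fourierCoeff_conj_z_mul_neg, h _ (by omega)]

theorem anti_conj_z_mul_neg {f : UnitAddCircle → ℂ} :
    Anti (fun t => conj (toCircle t : ℂ) * f (-t)) ↔ Hardy f := by
  refine ⟨fun h n hn => ?_, fun h n hn => ?_⟩
  · have := h (-n - 1) (by omega)
    rwa [fourierCoeff_conj_z_mul_neg, show -(-n - 1) - 1 = n by ring] at this
  · rw [fourierCoeff_conj_z_mul_neg, h _ (by omega)]

theorem hardy_congr {f g : UnitAddCircle → ℂ} (h : f =ᵐ[circleMeasure] g) : Hardy f ↔ Hardy g :=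
  ⟨fun hf => hf.congr h, fun hg => hg.congr h.symm⟩

theorem anti_congr {f g : UnitAddCircle → ℂ} (h : f =ᵐ[circleMeasure] g) : Anti f ↔ Anti g :=
  ⟨fun hf => hf.congr h, fun hg => hg.congr h.symm⟩

theorem memLp_conj {f : UnitAddCircle → ℂ} {p : ℝ≥0∞} (hf : MemLp f p circleMeasure) :
    MemLp (fun t => conj (f t)) p circleMeasure := hf.star

theorem inner_mulOp (θ : LInf) (h f : L2) :
    inner ℂ (mulOp θ h) f = fourierCoeff (fun t => conj (h t) * (conj (θ t) * f t)) 0 := by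
  rw [L2.inner_def]
  simp only [fourierCoeff, neg_zero, fourier_zero, one_smul]
  refine integral_congr_ae ?_
  filter_upwards [coeFn_mulOp θ h] with t ht
  rw [ht, RCLike.inner_apply, map_mul]; ring

/-- Orthogonality of f to θH² is orthogonality of conj(θ)f to H², which can be tested on the powers
zⁿ, n ≥ 0. -/
theorem mem_modelSpace_iff {θ : LInf} {f : L2} :
    f ∈ modelSpace θ ↔ Hardy f ∧ Anti fun t => conj (θ t) * f t := by
  refine and_congr Iff.rfl ⟨fun h n hn => ?_, fun h => ?_⟩
  · have hn' : fourierLp 2 n ∈ H2 := fun m hm => by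
      rw [fourierCoeff_congr_ae (coeFn_fourierLp 2 n), fourierCoeff_fourier]
      exact Pi.single_eq_of_ne (by omega) _
    have h1 := h _ (Submodule.mem_map_of_mem hn')
    rw [ContinuousLinearMap.coe_coe, inner_mulOp] at h1
    have h2 : (fun t => conj ((fourierLp 2 n : L2) t) * (conj (θ t) * f t)) =ᵐ[circleMeasure]
        fun t => fourier (-n) t * (conj (θ t) * f t) := by
      filter_upwards [coeFn_fourierLp (T := 1) 2 n] with t ht
      rw [ht, fourier_neg]
    rw [fourierCoeff_congr_ae h2, fourierCoeff_fourier_mul] at h1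
    simpa using h1
  · rintro _ ⟨u, hu, rfl⟩
    rw [ContinuousLinearMap.coe_coe, inner_mulOp]
    exact Anti.conj_mul (Lp.memLp u) (memLp_top_mul (memLp_conj (Lp.memLp θ)) (Lp.memLp f)) hu h
      0 le_rfl

/-- The flip exchanges analytic and antianalytic functions and turns multiplication by θ into
multiplication by θ˘. -/
theorem flip_mem_modelSpace_iff {θ : LInf} {f : L2} :
    flip f ∈ modelSpace θ ↔ Anti f ∧ Hardy fun t => conj (breve θ t) * f t := by
  have h1 : (fun t => conj (θ t) * flip f t) =ᵐ[circleMeasure]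
      fun t => conj (toCircle t : ℂ) * (fun s => conj (breve θ s) * f s) (-t) := by
    have hb := (measurePreserving_neg.quasiMeasurePreserving).ae (coeFn_breve θ)
    filter_upwards [coeFn_flip f, hb] with t ht h2
    rw [ht, h2, neg_neg]; ring
  rw [mem_modelSpace_iff]
  exact and_congr ((hardy_congr (coeFn_flip f)).trans hardy_conj_z_mul_neg)
    ((anti_congr h1).trans (anti_conj_z_mul_neg (f := fun s => conj (breve θ s) * f s)))

theorem bigTTO_apply_eq_zero_iff {θ φ : LInf} (f : modelSpace θ) :
    bigTTO θ φ f = 0 ↔ (Anti fun t => φ t * (f : L2) t) ∧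
      Hardy fun t => conj (breve θ t) * φ t * (f : L2) t := by
  have h0 : (bigTTO θ φ f : L2) = flip (mulOp φ f) -
    (modelSpace θ).starProjection (flip (mulOp φ f)) := rfl
  rw [← Submodule.coe_eq_zero, h0, sub_eq_zero, eq_comm, Submodule.starProjection_eq_self_iff,
    flip_mem_modelSpace_iff, anti_congr (coeFn_mulOp φ f)]
  refine and_congr Iff.rfl (hardy_congr ?_)
  filter_upwards [coeFn_mulOp φ f] with t ht
  rw [ht, mul_assoc]

theorem norm_breve {θ : LInf} (hθ : ∀ᵐ t ∂circleMeasure, ‖θ t‖ = 1) :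
    ∀ᵐ t ∂circleMeasure, ‖breve θ t‖ = 1 := by
  filter_upwards [coeFn_breve θ, (measurePreserving_neg.quasiMeasurePreserving).ae hθ] with t h1 h2
  rw [h1, h2]

theorem coeFn_star_mulInf (θ φ : LInf) :
    (star (mulInf θ φ) : LInf) =ᵐ[circleMeasure] fun t => conj (θ t * φ t) := by
  filter_upwards [Lp.coeFn_star (mulInf θ φ), coeFn_mulInf θ φ] with t h1 h2
  rw [h1, Pi.star_apply, h2]; rfl

theorem coeFn_mulInf_star (θ φ : LInf) :
    mulInf (star θ) φ =ᵐ[circleMeasure] fun t => conj (θ t) * φ t := by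
  filter_upwards [coeFn_mulInf (star θ) φ, Lp.coeFn_star θ] with t h1 h2
  rw [h1, h2]; rfl

/-- For unimodular θ the map s ↦ conj(θs) is an involution. -/
theorem mem_star_image_mulInf {θ φ : LInf} (hθ : ∀ᵐ t ∂circleMeasure, ‖θ t‖ = 1) (S : Set LInf) :
    φ ∈ star '' (mulInf θ '' S) ↔ star (mulInf θ φ) ∈ S := by
  constructor
  · rintro ⟨_, ⟨s, hs, rfl⟩, rfl⟩
    convert hs
    refine Lp.ext ?_
    filter_upwards [coeFn_star_mulInf θ (star (mulInf θ s)), coeFn_star_mulInf θ s, hθ]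
      with t h1 h2 h3
    have h4 := conj_mul_self_of_norm h3
    rw [h1, h2, map_mul, RCLike.conj_conj]
    linear_combination s t * h4
  · intro h
    refine ⟨_, ⟨_, h, rfl⟩, ?_⟩
    refine Lp.ext ?_
    filter_upwards [coeFn_star_mulInf θ (star (mulInf θ φ)), coeFn_star_mulInf θ φ, hθ]
      with t h1 h2 h3
    have h4 := conj_mul_self_of_norm h3
    rw [h1, h2, map_mul, RCLike.conj_conj]
    linear_combination φ t * h4

theorem mem_image_mulInf {θ φ : LInf} (hθ : ∀ᵐ t ∂circleMeasure, ‖θ t‖ = 1) (S : Set LInf) :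
    φ ∈ mulInf θ '' S ↔ mulInf (star θ) φ ∈ S := by
  constructor
  · rintro ⟨s, hs, rfl⟩
    convert hs
    refine Lp.ext ?_
    filter_upwards [coeFn_mulInf_star θ (mulInf θ s), coeFn_mulInf θ s, hθ] with t h1 h2 h3
    have h4 := conj_mul_self_of_norm h3
    rw [h1, h2]
    linear_combination s t * h4
  · intro h
    refine ⟨_, h, Lp.ext ?_⟩
    filter_upwards [coeFn_mulInf θ (mulInf (star θ) φ), coeFn_mulInf_star θ φ, hθ] with t h1 h2 h3
    have h4 := conj_mul_self_of_norm h3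
    rw [h1, h2]
    linear_combination φ t * h4

/-! ### Conjugation and projected polynomials in the model space -/

/-- The conjugation `f ↦ θ * conj (z * f)`, as a real-linear map. -/
noncomputable def conjOp (θ : LInf) : L2 →ₗ[ℝ] L2 :=
  ((mulOp θ ∘L mulOp (fourierLp ∞ (-1))).restrictScalars ℝ ∘L
    (Complex.conjCLE : ℂ →L[ℝ] ℂ).compLpL 2 circleMeasure).toLinearMap

theorem coeFn_conjOp (θ : LInf) (f : L2) :
    conjOp θ f =ᵐ[circleMeasure] fun t => θ t * (conj (toCircle t : ℂ) * conj (f t)) := by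
  have h3 := (Complex.conjCLE : ℂ →L[ℝ] ℂ).coeFn_compLpL (μ := circleMeasure) (p := 2) f
  have h2 := coeFn_mulOp (fourierLp ∞ (-1))
    ((Complex.conjCLE : ℂ →L[ℝ] ℂ).compLpL 2 circleMeasure f)
  have h1 := coeFn_mulOp θ (mulOp (fourierLp ∞ (-1))
    ((Complex.conjCLE : ℂ →L[ℝ] ℂ).compLpL 2 circleMeasure f))
  refine Filter.EventuallyEq.trans h1 ?_
  filter_upwards [h2, h3, coeFn_fourierLp (T := 1) ∞ (-1)] with t h2 h3 h4
  rw [h2, h3, h4, fourier_neg_one]; simp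

/-- Since conj(θ)·Cf = conj(zf), the conjugation swaps the two conditions defining the model space.
-/
theorem conjOp_mem_modelSpace {θ : LInf} (hθ : ∀ᵐ t ∂circleMeasure, ‖θ t‖ = 1) {f : L2}
    (hf : f ∈ modelSpace θ) : conjOp θ f ∈ modelSpace θ := by
  rw [mem_modelSpace_iff] at hf ⊢
  refine ⟨(hardy_conj_z_mul_conj.2 hf.2).congr ?_, (anti_conj_z_mul_conj.2 hf.1).congr ?_⟩
  · filter_upwards [coeFn_conjOp θ f] with t ht
    rw [ht, map_mul, RCLike.conj_conj]; ring
  · filter_upwards [coeFn_conjOp θ f, hθ] with t ht h1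
    have h2 := conj_mul_self_of_norm h1
    rw [ht]
    linear_combination (-(conj (toCircle t : ℂ) * conj (f t))) * h2

/-- Polynomials as elements of `L²`. -/
noncomputable def circLp : ℂ[X] →ₗ[ℂ] L2 where
  toFun p := (memLp_circ p 2).toLp
  map_add' p q := by
    rw [← MemLp.toLp_add]
    exact MemLp.toLp_congr _ _ (Eventually.of_forall fun t => by simp [circ])
  map_smul' c p := by
    rw [RingHom.id_apply, ← MemLp.toLp_const_smul]
    exact MemLp.toLp_congr _ _ (Eventually.of_forall fun t => by simp [circ])

theorem coeFn_circLp (p : ℂ[X]) : circLp p =ᵐ[circleMeasure] circ p :=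
  (memLp_circ p 2).coeFn_toLp

/-- Take b to be the analytic part of conj(θ)a. It is a polynomial because conj θ has only
frequencies ≤ 0. Then a − bθ is in the model space and bθ is in θH². -/
theorem exists_starProjection_circLp {θ : LInf} (hθ : IsInner θ) (a : ℂ[X]) :
    ∃ b : ℂ[X], b.natDegree ≤ a.natDegree ∧
      (modelSpace θ).starProjection (circLp a) =ᵐ[circleMeasure]
        fun t => circ a t - circ b t * θ t := by
  have hθc := memLp_conj (Lp.memLp θ)
  have hθH : Hardy θ := hθ.1
  obtain ⟨b, hb, hab⟩ := exists_circ_sub_anti (N := a.natDegree + 1)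
    (memLp_circ_mul a (hθc.mono_exponent le_top)) fun n hn => by
      rw [fourierCoeff_circ_mul a (hθc.mono_exponent le_top) (Nat.lt_succ_self _)]
      refine Finset.sum_eq_zero fun i hi => ?_
      have hi := Finset.mem_range.1 hi
      rw [fourierCoeff_conj, hθH _ (by push_cast at hn; omega), map_zero, mul_zero]
  have hbd : b.natDegree ≤ a.natDegree :=
    natDegree_le_iff_degree_le.2 (Order.le_of_lt_succ hb)
  have hg : MemLp (fun t => circ a t - circ b t * θ t) 2 circleMeasure :=
    (memLp_circ a 2).sub (memLp_circ_mul b ((Lp.memLp θ).mono_exponent le_top))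
  refine ⟨b, hbd, ?_⟩
  have : (modelSpace θ).starProjection (circLp a) = hg.toLp := by
    refine Submodule.eq_starProjection_of_mem_orthogonal ?_ ?_
    · rw [mem_modelSpace_iff]
      constructor
      · refine Hardy.congr ?_ hg.coeFn_toLp.symm
        exact Hardy.sub (memLp_circ a 2) (memLp_circ_mul b ((Lp.memLp θ).mono_exponent le_top))
          (hardy_circ a) (hθH.circ_mul b ((Lp.memLp θ).mono_exponent le_top))
      · refine hab.congr ?_
        filter_upwards [hg.coeFn_toLp, hθ.2] with t h1 h2
        have h3 := conj_mul_self_of_norm h2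
        rw [h1]
        linear_combination circ b t * h3
    · have h1 : circLp a - hg.toLp = mulOp θ (circLp b) := by
        refine Lp.ext ?_
        filter_upwards [Lp.coeFn_sub (circLp a) hg.toLp, coeFn_circLp a, coeFn_circLp b,
          hg.coeFn_toLp, coeFn_mulOp θ (circLp b)] with t h1 h2 h3 h4 h5
        rw [h1, Pi.sub_apply, h2, h4, h5, h3]; ring
      rw [h1]
      have h2 : circLp b ∈ H2 := (hardy_circ b).congr (coeFn_circLp b).symm
      exact fun f hf => Submodule.inner_left_of_mem_orthogonal
        (Submodule.mem_map_of_mem (f := (mulOp θ).toLinearMap) h2) hf.2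
  rw [this]
  exact hg.coeFn_toLp

theorem circ_ne_zero_of_roots {Q : ℂ[X]} (hQ : ∀ z, Q.eval z = 0 → ‖z‖ < 1) (t : UnitAddCircle) :
    circ Q t ≠ 0 := fun h => by
  have := hQ _ h
  rw [norm_z] at this
  exact lt_irrefl _ this

theorem mem_HInf_add_RatFun {ψ : LInf} {P : ℂ[X]} (hP : P ≠ 0)
    (h : Hardy fun t => circ P t * ψ t) : ψ ∈ HInf + RatFun := by
  obtain ⟨R, Q, hQ, hH⟩ :=
    exists_rational_of_circ_mul hP ((Lp.memLp ψ).mono_exponent le_top) h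
  have hr : MemLp (fun t => circ R t / circ Q t) ∞ circleMeasure :=
    memLp_of_continuous ((continuous_circ R).div (continuous_circ Q) (circ_ne_zero_of_roots hQ)) _
  refine Set.mem_add.2 ⟨ψ - hr.toLp, hH.congr ?_, hr.toLp, ⟨R, Q, hQ, hr.coeFn_toLp⟩,
    sub_add_cancel _ _⟩
  filter_upwards [Lp.coeFn_sub ψ hr.toLp, hr.coeFn_toLp] with t h1 h2
  rw [h1, Pi.sub_apply, h2]

/-! ### The two symbols -/

/-- The symbol `conj (θ φ)` attached to the antianalytic part of the operator. -/
noncomputable def symbolAnti (θ φ : LInf) : LInf := star (mulInf θ φ)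

/-- The symbol `conj θ˘ φ` attached to the part of the operator in `θ H²`. -/
noncomputable def symbolInner (θ φ : LInf) : LInf := mulInf (star (breve θ)) φ

theorem coeFn_symbolAnti (θ φ : LInf) :
    symbolAnti θ φ =ᵐ[circleMeasure] fun t => conj (θ t * φ t) := coeFn_star_mulInf θ φ

theorem coeFn_symbolInner (θ φ : LInf) :
    symbolInner θ φ =ᵐ[circleMeasure] fun t => conj (breve θ t) * φ t :=
  coeFn_mulInf_star (breve θ) φ

theorem bigTTO_apply_eq_zero_iff' {θ φ : LInf} (hθ : ∀ᵐ t ∂circleMeasure, ‖θ t‖ = 1)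
    (f : modelSpace θ) :
    bigTTO θ φ f = 0 ↔ (Anti fun t => conj (symbolAnti θ φ t) * (conj (θ t) * (f : L2) t)) ∧
      Hardy fun t => symbolInner θ φ t * (f : L2) t := by
  rw [bigTTO_apply_eq_zero_iff]
  refine and_congr (anti_congr ?_) (hardy_congr ?_)
  · filter_upwards [coeFn_symbolAnti θ φ, hθ] with t h1 h2
    have h3 := conj_mul_self_of_norm h2
    rw [h1, RCLike.conj_conj]
    linear_combination (-(φ t * (f : L2) t)) * h3
  · filter_upwards [coeFn_symbolInner θ φ] with t h1
    rw [h1]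

/-- Together with the next lemma, this turns the antianalytic kernel conditions at f and Cf into
analytic conditions on ψ₁, of the same shape as those on ψ₂. -/
theorem hardy_symbolAnti_mul {θ φ : LInf} {f : modelSpace θ}
    (h : Anti fun t => φ t * conjOp θ f t) : Hardy fun t => symbolAnti θ φ t * (f : L2) t := by
  refine (hardy_conj_z_mul_conj.2 h).congr ?_
  filter_upwards [coeFn_symbolAnti θ φ, coeFn_conjOp θ f] with t h1 h2
  have h3 := conj_z_mul_z t
  rw [h1, h2]
  simp only [map_mul, RCLike.conj_conj]
  linear_combination (conj (φ t) * conj (θ t) * (f : L2) t) * h3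

theorem hardy_symbolAnti_mul_conjOp {θ φ : LInf} (hθ : ∀ᵐ t ∂circleMeasure, ‖θ t‖ = 1)
    {f : modelSpace θ} (h : Anti fun t => φ t * (f : L2) t) :
    Hardy fun t => symbolAnti θ φ t * conjOp θ f t := by
  refine (hardy_conj_z_mul_conj.2 h).congr ?_
  filter_upwards [coeFn_symbolAnti θ φ, coeFn_conjOp θ f, hθ] with t h1 h2 h3
  have h4 := conj_mul_self_of_norm h3
  rw [h1, h2]
  simp only [map_mul]
  linear_combination (-(conj (φ t) * conj (toCircle t : ℂ) * conj ((f : L2) t))) * h4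

/-- The conjugation of the model space. -/
noncomputable def conjModel (θ : LInf) (hθ : ∀ᵐ t ∂circleMeasure, ‖θ t‖ = 1) :
    modelSpace θ →ₗ[ℝ] modelSpace θ where
  toFun f := ⟨conjOp θ f, conjOp_mem_modelSpace hθ f.2⟩
  map_add' f g := Subtype.ext (by simp)
  map_smul' c f := Subtype.ext (by
    change conjOp θ (c • (f : L2)) = c • conjOp θ f
    rw [map_smul])

/-- The projection of a polynomial to the model space. -/
noncomputable def polyModel (θ : LInf) : ℂ[X] →ₗ[ℂ] modelSpace θ :=
  ((modelSpace θ).orthogonalProjectionOnto).toLinearMap ∘ₗ circLp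

theorem coe_polyModel (θ : LInf) (a : ℂ[X]) :
    (polyModel θ a : L2) = (modelSpace θ).starProjection (circLp a) := rfl

theorem exists_circ_mul_symbols {θ φ : LInf} (hθ : IsInner θ) {a : ℂ[X]}
    (h1 : bigTTO θ φ (polyModel θ a) = 0)
    (h2 : bigTTO θ φ (conjModel θ hθ.2 (polyModel θ a)) = 0) (h0 : polyModel θ a ≠ 0) :
    (∃ P : ℂ[X], P ≠ 0 ∧ P.natDegree ≤ 2 * a.natDegree ∧
      Hardy fun t => circ P t * symbolAnti θ φ t) ∧
    ∃ P : ℂ[X], P ≠ 0 ∧ P.natDegree ≤ 2 * a.natDegree ∧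
      Hardy fun t => circ P t * symbolInner θ φ t := by
  obtain ⟨b, hb, hab⟩ := exists_starProjection_circLp hθ a
  rw [← coe_polyModel] at hab
  set g := polyModel θ a with hg
  have hCg : (conjOp θ g : L2) =ᵐ[circleMeasure] fun t => conj (toCircle t : ℂ) *
      (conj (circ a t) * θ t - conj (circ b t)) := by
    filter_upwards [coeFn_conjOp θ g, hab, hθ.2] with t h1 h2 h3
    have h4 := conj_mul_self_of_norm h3
    rw [h1, h2, map_sub, map_mul]
    linear_combination (-(conj (toCircle t : ℂ) * conj (circ b t))) * h4
  have hanti := (mem_modelSpace_iff.1 g.2).2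
  have hanti' : Anti fun t => conj (θ t) * (circ a t - circ b t * θ t) := by
    refine hanti.congr ?_
    filter_upwards [hab] with t h
    rw [h]
  have hne : ¬ (fun t => circ a t - circ b t * θ t) =ᵐ[circleMeasure] 0 := fun h =>
    h0 (Subtype.ext (Lp.ext ((hab.trans h).trans (Lp.coeFn_zero _ _ _).symm)))
  have key : ∀ ψ : LInf, (Hardy fun t => ψ t * (g : L2) t) →
      (Hardy fun t => ψ t * conjOp θ g t) → ∃ P : ℂ[X], P ≠ 0 ∧ P.natDegree ≤ 2 * a.natDegree ∧
      Hardy fun t => circ P t * ψ t := by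
    intro ψ hψ1 hψ2
    refine exists_circ_mul_hardy (Lp.memLp θ) hθ.2 (Lp.memLp ψ) le_rfl hb hanti' hne
      (hψ1.congr ?_) (hψ2.congr ?_)
    · filter_upwards [hab] with t h
      rw [h]
    · filter_upwards [hCg] with t h
      rw [h]
  have e1 := (bigTTO_apply_eq_zero_iff _).1 h1
  have e2 := (bigTTO_apply_eq_zero_iff _).1 h2
  exact ⟨key _ (hardy_symbolAnti_mul e2.1) (hardy_symbolAnti_mul_conjOp hθ.2 e1.1),
    key _ ((bigTTO_apply_eq_zero_iff' hθ.2 _).1 h1).2 ((bigTTO_apply_eq_zero_iff' hθ.2 _).1 h2).2⟩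

theorem circ_eq_of_polyModel_eq_zero {θ : LInf} (hθ : IsInner θ) {a : ℂ[X]}
    (h : polyModel θ a = 0) : ∃ b : ℂ[X], b.natDegree ≤ a.natDegree ∧
      circ a =ᵐ[circleMeasure] fun t => circ b t * θ t := by
  obtain ⟨b, hb, hab⟩ := exists_starProjection_circLp hθ a
  rw [← coe_polyModel, h] at hab
  refine ⟨b, hb, ?_⟩
  filter_upwards [hab, Lp.coeFn_zero ℂ 2 circleMeasure] with t h1 h2
  have h3 : (0 : ℂ) = circ a t - circ b t * θ t := by
    rw [← h1]; exact h2.symm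
  exact (sub_eq_zero.1 h3.symm)

theorem hardy_of_circ_mul_const {f : UnitAddCircle → ℂ} (hf : MemLp f 2 circleMeasure) {P : ℂ[X]}
    (hP : P ≠ 0) (hd : P.natDegree = 0) (h : Hardy fun t => circ P t * f t) : Hardy f := by
  refine Hardy.of_circ_mul hP (fun z hz => ?_) hf h
  rw [eq_C_of_natDegree_eq_zero hd] at hz hP
  rw [eval_C] at hz
  simp [hz] at hP

/-! ### Vanishing, and necessity for finite rank -/

theorem bigTTO_eq_zero_iff {θ φ : LInf} (hθ : IsInner θ) (hc : ¬ IsConstant θ) :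
    bigTTO θ φ = 0 ↔ symbolAnti θ φ ∈ HInf ∧ symbolInner θ φ ∈ HInf := by
  constructor
  · intro h
    -- The projection of 1 is 1 − bθ with b constant; if it vanished, θ would be constant.
    have hne : polyModel θ 1 ≠ 0 := by
      intro h0
      obtain ⟨b, hb, hab⟩ := circ_eq_of_polyModel_eq_zero hθ h0
      rw [natDegree_one, Nat.le_zero] at hb
      refine hc ⟨(b.coeff 0)⁻¹, ?_⟩
      filter_upwards [hab] with t ht
      rw [eq_C_of_natDegree_eq_zero hb] at ht
      simp only [circ, eval_one, eval_C] at ht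
      exact eq_inv_of_mul_eq_one_right ht.symm
    obtain ⟨⟨P, hP, hPd, hPh⟩, Q, hQ, hQd, hQh⟩ :=
      exists_circ_mul_symbols (φ := φ) hθ (a := 1) (by rw [h]; rfl) (by rw [h]; rfl) hne
    -- The degree bound 2·0 makes the multipliers P and Q constants.
    rw [natDegree_one, Nat.le_zero] at hPd hQd
    exact ⟨hardy_of_circ_mul_const ((Lp.memLp _).mono_exponent le_top) hP hPd hPh,
      hardy_of_circ_mul_const ((Lp.memLp _).mono_exponent le_top) hQ hQd hQh⟩
  · rintro ⟨h1, h2⟩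
    ext1 f
    refine (bigTTO_apply_eq_zero_iff' hθ.2 f).2 ?_
    obtain ⟨h3, h4⟩ := mem_modelSpace_iff.1 f.2
    exact ⟨Anti.conj_mul ((Lp.memLp _).mono_exponent le_top)
        (memLp_top_mul (memLp_conj (Lp.memLp θ)) (Lp.memLp _)) h1 h4,
      Hardy.mul ((Lp.memLp _).mono_exponent le_top) (Lp.memLp _) h2 h3⟩

theorem mem_of_isFiniteRank {θ φ : LInf} (hθ : IsInner θ) (hB : ¬ IsFiniteBlaschke θ)
    (h : IsFiniteRank (bigTTO θ φ)) :
    symbolAnti θ φ ∈ HInf + RatFun ∧ symbolInner θ φ ∈ HInf + RatFun := by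
  set T := (bigTTO θ φ).toLinearMap with hT
  have hfin : FiniteDimensional ℂ (LinearMap.range T) := h
  have hfinR : FiniteDimensional ℝ (LinearMap.range T) := Module.Finite.trans ℂ _
  let Tr : modelSpace θ →ₗ[ℝ] LinearMap.range T := T.rangeRestrict.restrictScalars ℝ
  let p : ℂ[X] →ₗ[ℝ] modelSpace θ := (polyModel θ).restrictScalars ℝ
  -- Conjugation is only real-linear, so the dimension count is over ℝ: a nonzero element of ker L
  -- puts both g and Cg in the kernel.
  let L : ℂ[X] →ₗ[ℝ] LinearMap.range T × LinearMap.range T :=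
    (Tr ∘ₗ p).prod (Tr ∘ₗ conjModel θ hθ.2 ∘ₗ p)
  have hL : ¬ Function.Injective L := fun hi => by
    have h1 : Module.Finite ℝ ℂ[X] := Module.Finite.of_injective L hi
    exact Polynomial.not_finite (R := ℂ) (Module.Finite.of_restrictScalars_finite ℝ ℂ _)
  rw [← LinearMap.ker_eq_bot, ← ne_eq, Submodule.ne_bot_iff] at hL
  obtain ⟨a, ha, ha0⟩ := hL
  have ha' : L a = 0 := ha
  have h1 : bigTTO θ φ (polyModel θ a) = 0 := congrArg Subtype.val (congrArg Prod.fst ha')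
  have h2 : bigTTO θ φ (conjModel θ hθ.2 (polyModel θ a)) = 0 :=
    congrArg Subtype.val (congrArg Prod.snd ha')
  have hne : polyModel θ a ≠ 0 := by
    intro h0
    obtain ⟨b, -, hab⟩ := circ_eq_of_polyModel_eq_zero hθ h0
    refine hB (isFiniteBlaschke_of_circ_mul hθ ?_ hab)
    rintro rfl
    refine ha0 (circ_eq_zero ?_)
    filter_upwards [hab] with t ht
    rw [ht]; simp [circ]
  obtain ⟨⟨P, hP, -, hPh⟩, Q, hQ, -, hQh⟩ := exists_circ_mul_symbols hθ h1 h2 hne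
  exact ⟨mem_HInf_add_RatFun hP hPh, mem_HInf_add_RatFun hQ hQh⟩

/-! ### Sufficiency for finite rank -/

theorem finiteDimensional_range_of_functionals {E F ι : Type*} [AddCommGroup E] [Module ℂ E]
    [AddCommGroup F] [Module ℂ F] [Finite ι] (T : E →ₗ[ℂ] F) (l : ι → E →ₗ[ℂ] ℂ)
    (h : ∀ f, (∀ i, l i f = 0) → T f = 0) : FiniteDimensional ℂ (LinearMap.range T) := by
  have hle : LinearMap.ker (LinearMap.pi l) ≤ LinearMap.ker T := fun f hf =>
    h f fun i => congrFun (LinearMap.mem_ker.1 hf) i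
  have h1 : FiniteDimensional ℂ (E ⧸ LinearMap.ker (LinearMap.pi l)) :=
    Module.Finite.equiv (LinearMap.pi l).quotKerEquivRange.symm
  have h2 : FiniteDimensional ℂ (E ⧸ LinearMap.ker T) :=
    Module.Finite.of_surjective _ (Submodule.factor_surjective hle)
  exact Module.Finite.equiv T.quotKerEquivRange

/-- A Fourier coefficient as a linear functional on `L²`. -/
noncomputable def coeffFunctional (n : ℤ) : L2 →ₗ[ℂ] ℂ :=
  (innerSL ℂ (fourierBasis (T := 1) n)).toLinearMap

theorem coeffFunctional_apply (n : ℤ) (f : L2) : coeffFunctional n f = fourierCoeff f n :=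
  inner_fourierBasis n f

/-- If qθ = p, then p·conj(θ)f = qf is analytic, so the antianalytic function conj(θ)f is determined
by deg p coefficients. Hence finitely many functionals separate the points of the model space. -/
theorem isFiniteRank_of_isFiniteBlaschke {θ φ : LInf} (hθ : IsInner θ) (hB : IsFiniteBlaschke θ) :
    IsFiniteRank (bigTTO θ φ) := by
  obtain ⟨p, q, hp, hpq⟩ := hB.exists_circ
  refine finiteDimensional_range_of_functionals (ι := Fin p.natDegree) _
    (fun j => coeffFunctional (-1 - j) ∘ₗ (mulOp (star θ)).toLinearMap ∘ₗ (modelSpace θ).subtype) ?_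
  intro f hf
  obtain ⟨h3, h4⟩ := mem_modelSpace_iff.1 f.2
  have hm : (mulOp (star θ) f : L2) =ᵐ[circleMeasure] fun t => conj (θ t) * (f : L2) t := by
    filter_upwards [coeFn_mulOp (star θ) f, Lp.coeFn_star θ] with t h1 h2
    rw [h1, h2]; rfl
  have h4' := h4.congr hm.symm
  have h5 : Hardy (mulOp (star θ) f) := by
    refine Hardy.of_circ_mul_of_coeff hp (Lp.memLp _)
      ((h3.circ_mul q (Lp.memLp _)).congr ?_) fun j hj => ?_
    · filter_upwards [hm, hpq, hθ.2] with t h1 h2 h3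
      have h6 := conj_mul_self_of_norm h3
      rw [h1, ← h2]
      linear_combination (-(circ q t * (f : L2) t)) * h6
    · rw [← coeffFunctional_apply]
      exact hf ⟨j, hj⟩
  have h6 := Hardy.ae_eq_zero (Lp.memLp _) h5 h4'
  have h7 : f = 0 := by
    refine Subtype.ext (Lp.ext ?_)
    filter_upwards [h6, hm, hθ.2, Lp.coeFn_zero ℂ 2 circleMeasure] with t h1 h2 h3 h8
    have h9 := conj_mul_self_of_norm h3
    rw [h2] at h1
    refine Eq.trans ?_ h8.symm
    have h1' : conj (θ t) * (f : L2) t = 0 := h1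
    rw [Pi.zero_apply]
    linear_combination θ t * h1' - (f : L2) t * h9
  rw [h7, map_zero]

/-- With r = R/Q the product Q·rf = Rf is analytic, so only deg Q coefficients of rf need to be
checked. -/
theorem RatFun.hardy_mul_of_coeff {r : LInf} {R Q : ℂ[X]} (hQ : ∀ z, Q.eval z = 0 → ‖z‖ < 1)
    (hr : r =ᵐ[circleMeasure] fun t => circ R t / circ Q t) {f : UnitAddCircle → ℂ}
    (hf' : MemLp f 2 circleMeasure) (hf : Hardy f)
    (h : ∀ j : ℕ, j < Q.natDegree → fourierCoeff (fun t => r t * f t) (-1 - j) = 0) :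
    Hardy fun t => r t * f t := by
  have hQ0 : Q ≠ 0 := by
    rintro rfl
    have := hQ 1 (by simp)
    simp at this
  refine Hardy.of_circ_mul_of_coeff hQ0 (memLp_top_mul (Lp.memLp r) hf')
    ((hf.circ_mul R hf').congr ?_) h
  filter_upwards [hr] with t ht
  have := circ_ne_zero_of_roots hQ t
  rw [ht]
  field_simp

theorem RatFun.anti_conj_mul_of_coeff {r : LInf} {R Q : ℂ[X]}
    (hQ : ∀ z, Q.eval z = 0 → ‖z‖ < 1)
    (hr : r =ᵐ[circleMeasure] fun t => circ R t / circ Q t) {f : UnitAddCircle → ℂ}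
    (hf' : MemLp f 2 circleMeasure) (hf : Anti f)
    (h : ∀ j : ℕ, j < Q.natDegree → fourierCoeff (fun t => conj (r t) * f t) j = 0) :
    Anti fun t => conj (r t) * f t := by
  have hz : MemLp (fun t : UnitAddCircle => conj (toCircle t : ℂ)) ∞ circleMeasure :=
    (memLp_conj (memLp_circ X ∞)).ae_eq (Eventually.of_forall fun t => by simp [circ])
  have e : (fun t => conj (toCircle t : ℂ) * conj (conj (r t) * f t)) =
      fun t => r t * (conj (toCircle t : ℂ) * conj (f t)) := by
    ext t; rw [map_mul, RCLike.conj_conj]; ring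
  rw [← hardy_conj_z_mul_conj, e]
  refine RatFun.hardy_mul_of_coeff hQ hr (memLp_top_mul hz (memLp_conj hf'))
    (hardy_conj_z_mul_conj.2 hf) fun j hj => ?_
  rw [← e, fourierCoeff_conj_z_mul_conj, show -(-1 - (j : ℤ)) - 1 = j by ring, h j hj, map_zero]

theorem isFiniteRank_of_mem {θ φ : LInf} (hθ : IsInner θ) (h₁ : symbolAnti θ φ ∈ HInf + RatFun)
    (h₂ : symbolInner θ φ ∈ HInf + RatFun) : IsFiniteRank (bigTTO θ φ) := by
  obtain ⟨u₁, hu₁, r₁, ⟨R₁, Q₁, hQ₁, hr₁⟩, e₁⟩ := Set.mem_add.1 h₁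
  obtain ⟨u₂, hu₂, r₂, ⟨R₂, Q₂, hQ₂, hr₂⟩, e₂⟩ := Set.mem_add.1 h₂
  -- The H^∞ parts of the symbols impose no condition; the rational parts impose deg Q₁ conditions
  -- on conj(r₁)·conj(θ)f and deg Q₂ on r₂f.
  refine finiteDimensional_range_of_functionals (ι := Fin Q₁.natDegree ⊕ Fin Q₂.natDegree) _
    (Sum.elim
      (fun j => coeffFunctional j ∘ₗ (mulOp (star r₁)).toLinearMap ∘ₗ
        (mulOp (star θ)).toLinearMap ∘ₗ (modelSpace θ).subtype)
      (fun j => coeffFunctional (-1 - j) ∘ₗ (mulOp r₂).toLinearMap ∘ₗ (modelSpace θ).subtype)) ?_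
  intro f hf
  obtain ⟨h3, h4⟩ := mem_modelSpace_iff.1 f.2
  have hw : MemLp (fun t => conj (θ t) * (f : L2) t) 2 circleMeasure :=
    memLp_top_mul (memLp_conj (Lp.memLp θ)) (Lp.memLp _)
  refine (bigTTO_apply_eq_zero_iff' hθ.2 f).2 ⟨?_, ?_⟩
  · have hm : (mulOp (star r₁) (mulOp (star θ) f) : L2) =ᵐ[circleMeasure]
        fun t => conj (r₁ t) * (conj (θ t) * (f : L2) t) := by
      filter_upwards [coeFn_mulOp (star r₁) (mulOp (star θ) f), coeFn_mulOp (star θ) f,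
        Lp.coeFn_star θ, Lp.coeFn_star r₁] with t h1 h2 h5 h6
      rw [h1, h2, h5, h6]; rfl
    have hA := RatFun.anti_conj_mul_of_coeff hQ₁ hr₁ hw h4 fun j hj => by
      rw [← fourierCoeff_congr_ae hm, ← coeffFunctional_apply]
      exact hf (Sum.inl ⟨j, hj⟩)
    have hB := Anti.conj_mul ((Lp.memLp u₁).mono_exponent le_top) hw hu₁ h4
    intro n hn
    have hs := congrFun (fourierCoeff.add
      ((memLp_top_mul (memLp_conj (Lp.memLp u₁)) hw).integrable one_le_two)
      ((memLp_top_mul (memLp_conj (Lp.memLp r₁)) hw).integrable one_le_two)) n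
    rw [Pi.add_apply, hA n hn, hB n hn, add_zero] at hs
    rw [← hs]
    refine congrFun (fourierCoeff_congr_ae ?_) n
    filter_upwards [Lp.coeFn_add u₁ r₁] with t h1
    rw [← e₁, h1, Pi.add_apply, Pi.add_apply, map_add]; ring
  · have hm := coeFn_mulOp r₂ (f : L2)
    have hA := RatFun.hardy_mul_of_coeff hQ₂ hr₂ (Lp.memLp _) h3 fun j hj => by
      rw [← fourierCoeff_congr_ae hm, ← coeffFunctional_apply]
      exact hf (Sum.inr ⟨j, hj⟩)
    refine (Hardy.add (memLp_top_mul (Lp.memLp u₂) (Lp.memLp _))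
      (memLp_top_mul (Lp.memLp r₂) (Lp.memLp _))
      (Hardy.mul ((Lp.memLp u₂).mono_exponent le_top) (Lp.memLp _) hu₂ h3) hA).congr ?_
    filter_upwards [Lp.coeFn_add u₂ r₂] with t h1
    rw [← e₂, h1, Pi.add_apply]; ring

end BTTO

theorem mainTheorem8 (θ φ : BTTO.LInf) (hθ : BTTO.IsInner θ) :
    (¬ BTTO.IsConstant θ →
      (BTTO.bigTTO θ φ = 0 ↔
        φ ∈ (star '' (BTTO.mulInf θ '' BTTO.HInf)) ∩
          (BTTO.mulInf (BTTO.breve θ) '' BTTO.HInf))) ∧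
    (BTTO.IsFiniteRank (BTTO.bigTTO θ φ) ↔
      BTTO.IsFiniteBlaschke θ ∨
        φ ∈ (star '' (BTTO.mulInf θ '' (BTTO.HInf + BTTO.RatFun))) ∩
          (BTTO.mulInf (BTTO.breve θ) '' (BTTO.HInf + BTTO.RatFun))) := by
  rw [Set.mem_inter_iff, Set.mem_inter_iff, BTTO.mem_star_image_mulInf hθ.2,
    BTTO.mem_star_image_mulInf hθ.2, BTTO.mem_image_mulInf (BTTO.norm_breve hθ.2),
    BTTO.mem_image_mulInf (BTTO.norm_breve hθ.2)]
  refine ⟨fun hc => BTTO.bigTTO_eq_zero_iff hθ hc, fun h => ?_, ?_⟩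
  · by_cases hB : BTTO.IsFiniteBlaschke θ
    · exact Or.inl hB
    · exact Or.inr (BTTO.mem_of_isFiniteRank hθ hB h)
  · rintro (hB | ⟨h1, h2⟩)
    · exact BTTO.isFiniteRank_of_isFiniteBlaschke hθ hB
    · exact BTTO.isFiniteRank_of_mem hθ h1 h2
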